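/- Let $h:\mathbb{R}\to\mathbb{R}$ be a smooth function with $h(y)=0$ for $y\le 0$, $0<h(y)<\pi/2$ for $0<y<1$ and $h(y)=\pi/2$ for $y\ge 1$, and let $\lambda>0$. Put $B(y)=0$ for $y\le 0$, $B(y)=\exp\bigl(-\int_y^1\cot(h(z))\,dz\bigr)$ for $0<y<1$, $B(y)=1$ for $y\ge 1$, and for $K>0$ let $$R_K(y)=\begin{cases}-e^{-iKy}, & y\le 0,\\ -e^{-iKy}-\dfrac{2iK}{B(y)}\displaystyle\int_0^y B(z)\,e^{-iKz}\,dz, & y>0.\end{cases}$$ For $t,r>0$ define $$A(t,r)=\frac{\lambda^2}{16\pi^2r^2}\int_0^\infty\frac{dK}{K}\Bigl[\bigl|R_K'(\lambda(t-r))\bigr|^2-K^2\Bigr],$$ $$\mathcal{G}_\lambda(t,r)=\int_0^\infty\frac{dK}{K}\Bigl[\bigl|R_K(\lambda(t-r))\bigr|^2+2\cos(2K\lambda r)-1+R_K(\lambda(t-r))e^{iK\lambda(t+r)}+\overline{R_K(\lambda(t-r))}\,e^{-iK\lambda(t+r)}\Bigr],$$ the latter as an improper integral $\lim_{M\to\infty}\int_0^M$,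 and the renormalised energy density $$\langle T_{00}\rangle(t,r)=A(t,r)-\frac{1}{32\pi^2r^2}\,\frac{\partial}{\partial r}\left(\frac{\mathcal{G}_\lambda(t,r)}{r}\right).$$ Fix $t>0$. (i) For every $0<r\le t$ (in particular for $r\le t\le r+1/\lambda$, $r>0$), $\langle T_{00}\rangle(t,r)$ is well defined: $R_K$ is differentiable on $\mathbb{R}$ for every $K>0$, the integral in $A(t,r)$ converges absolutely, the improper integral defining $\mathcal{G}_\lambda(t,r)$ converges (its integrand being integrable on each $(0,M]$), and $\mathcal{G}_\lambda(t,\cdot)$ is differentiable at $r$. The functions $A(t,\cdot)$, $\partial_r\mathcal{G}_\lambda(t,\cdot)$ and $\langle T_{00}\rangle(t,\cdot)$ are continuous on $0<r<t$, and $\langle T_{00}\rangle(t,t)=0$. (ii) Assume in addition that $(\tan h)'''(y)\ge 0$ for all sufficiently small $y>0$. Then $\partial_r\mathcal{G}_\lambda(t,\cdot)$ is continuous on $0<r\le t$, with value $0$ at $r=t$. However, $A(t,r)\to-\infty$ as $r\to t^-$, faster than any negative multiple of $1/h(\lambda(t-r))$: for every $C>0$, $A(t,r)<-C/h(\lambda(t-r))$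 for all $r<t$ sufficiently close to $t$. The same two statements hold for $\langle T_{00}\rangle(t,r)$ in place of $A(t,r)$. Consequently every shell around $r=t$ contains energy $-\infty$: for all $0<a<t<b$, the positive part of $4\pi r^2\langle T_{00}\rangle(t,r)$ has a finite integral over $a<r<b$, and its negative part has an infinite one. -/

import Mathlib

open Set Filter Topology MeasureTheory
open scoped ContDiff

noncomputable section

namespace PointSource

/-- The dimensionless interpolation profile `h`: smooth, `0` on `(-∞, 0]`, strictly between `0`
and `π / 2` on `(0, 1)`, and `π / 2` on `[1, ∞)`. -/
structure IsProfile (h : ℝ → ℝ) : Prop where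
  smooth : ContDiff ℝ ∞ h
  eq_zero : ∀ y, y ≤ 0 → h y = 0
  pos : ∀ y, 0 < y → y < 1 → 0 < h y
  lt_pi_div_two : ∀ y, 0 < y → y < 1 → h y < Real.pi / 2
  eq_pi_div_two : ∀ y, 1 ≤ y → h y = Real.pi / 2

/-- The auxiliary function `B`. -/
def auxB (h : ℝ → ℝ) (y : ℝ) : ℝ :=
  if y ≤ 0 then 0
  else if y < 1 then Real.exp (-∫ z in y..1, Real.cot (h z))
  else 1

/-- The dimensionless outgoing part `R_K(y)` of the mode function of dimensionless
frequency `K`. -/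
def modeR (h : ℝ → ℝ) (K y : ℝ) : ℂ :=
  if y ≤ 0 then -Complex.exp (-(Complex.I * K * y))
  else -Complex.exp (-(Complex.I * K * y))
    - (2 * Complex.I * K / (auxB h y : ℂ))
      * ∫ z in (0 : ℝ)..y, (auxB h z : ℂ) * Complex.exp (-(Complex.I * K * z))

/-- `(|R_K'(λ(t - r))|² - K²) / K`, where the prime is the derivative in the argument. -/
def fluxIntegrand (h : ℝ → ℝ) (lam t r K : ℝ) : ℝ :=
  (‖deriv (modeR h K) (lam * (t - r))‖ ^ 2 - K ^ 2) / K

/-- The first term of the renormalised energy density. -/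
def fluxTerm (h : ℝ → ℝ) (lam t r : ℝ) : ℝ :=
  lam ^ 2 / (16 * Real.pi ^ 2 * r ^ 2) * ∫ K in Ioi (0 : ℝ), fluxIntegrand h lam t r K

/-- The integrand (including the factor `1 / K`) of `𝒢_λ(t, r)`; the bracket is real. -/
def calGIntegrand (h : ℝ → ℝ) (lam t r K : ℝ) : ℝ :=
  (‖modeR h K (lam * (t - r))‖ ^ 2 + 2 * Real.cos (2 * K * lam * r) - 1
    + (modeR h K (lam * (t - r)) * Complex.exp (Complex.I * K * lam * (t + r))
      + (starRingEnd ℂ) (modeR h K (lam * (t - r)))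
        * Complex.exp (-(Complex.I * K * lam * (t + r)))).re) / K

/-- `f` has the improper integral `L` over `(0, ∞)`: it is integrable over every `(0, M)`, and
these integrals tend to `L` as `M → ∞`. -/
def HasImproperIntegral (f : ℝ → ℝ) (L : ℝ) : Prop :=
  (∀ M : ℝ, 0 < M → IntegrableOn f (Ioc 0 M)) ∧
    Tendsto (fun M : ℝ => ∫ K in Ioc 0 M, f K) atTop (𝓝 L)

/-- `𝒢_λ(t, r)`, an improper integral over `0 < K < ∞`. -/
def calG (h : ℝ → ℝ) (lam t r : ℝ) : ℝ :=
  limUnder atTop (fun M : ℝ => ∫ K in Ioc 0 M, calGIntegrand h lam t r K)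

/-- The renormalised energy density `⟨T₀₀⟩` at time `t` and radius `r`. -/
def energyDensity (h : ℝ → ℝ) (lam t r : ℝ) : ℝ :=
  fluxTerm h lam t r
    - 1 / (32 * Real.pi ^ 2 * r ^ 2) * deriv (fun ρ : ℝ => calG h lam t ρ / ρ) r

end PointSource

end

/-! Put `y = λ(t - r)` and `T = tan h`. On `y < 1` the auxiliary function satisfies `B = T B'`, and
it extends smoothly by zero through `y = 0`. Writing `C`, `S` for the convolutions of `B` with `cos
(K ·)`, `sin (K ·)` over `(0, y)`, the mode function is a unimodular phase times an expression in `K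
C / B` and `K S / B`. The identity `mul_sq_add_sq_sub` replaces the quadratic expression `K (C² +
S²) - B S` by minus an integral of `waveKernel`, which is linear in the convolutions. Both frequency
integrands thus reduce to `waveKernel`, plus a sine transform of `B` in the case of `𝒢`.

The kernel is a sine transform of `(u - z)` times the divided Wronskian. Integrating over `0 < K <
M` produces a factor `1 - cos (M(u - z))`, and Riemann–Lebesgue gives the limit `waveTotal`.
Repeated integration by parts bounds the kernel by a multiple of `1 / K²`, so the flux integral is
absolutely convergent. This yields closed forms: `fluxTotal` for the flux, and `𝒢 = 4 (selfPart +
crossPart)`. Regularity for `0 < r < t` is read off from them. At `r = t` the flatness of `T` at `0`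
makes `selfPart + crossPart` of order `o(y)`, so `𝒢` has derivative zero there.

For the behaviour at the light cone, `B = T B'` turns the Wronskian into `B'(u) B'(z) (T(z) -
T(u))`. If `T''' ≥ 0` near `0⁺`, then with `p = T'(y)` and `q = T''(y)` all slopes of `T` on `[0,
y]` lie below `p`, and those on `[z, y]` above `p - (y - z) q`; hence `-waveTotal` is `p B B'` up to
errors controlled by `q T`. In `fluxTotal` the two leading terms are `-4p/T²` and `2p/T²`, and the
remaining `-2p/T²` is at most a negative multiple of `1 / (y h)` (`TanBounds.fluxTotal_le`). In the
derivative of `selfPart` the leading terms cancel, leaving at most `2q → 0`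
(`TanBounds.abs_selfPartDeriv_le`), and the derivative of `crossPart` also tends to zero. So the
flux alone decides the limit. Since `h(y) ≤ y` near `0⁺`, the energy density lies below a negative
multiple of `1 / (t - r)`, which is not integrable at `t`. -/

noncomputable section

namespace PointSource

/-! ### Smoothness of `B` across the origin -/

section

variable {h : ℝ → ℝ}

theorem deriv_eq_zero_of_eq_zero_nonpos {f : ℝ → ℝ} (hf : Differentiable ℝ f)
    (h0 : ∀ y, y ≤ 0 → f y = 0) {y : ℝ} (hy : y ≤ 0) : deriv f y = 0 := by
  have h1 : HasDerivWithinAt f (deriv f y) (Iic 0) y := (hf y).hasDerivAt.hasDerivWithinAt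
  have h2 : HasDerivWithinAt f 0 (Iic 0) y :=
    (hasDerivWithinAt_const y (Iic 0) (0 : ℝ)).congr (fun z hz => h0 z hz) (h0 y hy)
  exact (uniqueDiffOn_Iic (0 : ℝ) y hy).eq_deriv _ h1 h2

theorem IsProfile.sin_pos (hh : IsProfile h) {y : ℝ} (hy : 0 < y) : 0 < Real.sin (h y) := by
  rcases lt_or_ge y 1 with h1 | h1
  · exact Real.sin_pos_of_pos_of_lt_pi (hh.pos y hy h1)
      (by linarith [hh.lt_pi_div_two y hy h1, Real.pi_pos])
  · simp [hh.eq_pi_div_two y h1]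

theorem IsProfile.continuousOn_cot (hh : IsProfile h) :
    ContinuousOn (fun z => Real.cot (h z)) (Ioi 0) := by
  have : (fun z => Real.cot (h z)) = fun z => Real.cos (h z) / Real.sin (h z) := by
    funext z; exact Real.cot_eq_cos_div_sin _
  rw [this]
  have hc := hh.smooth.continuous
  exact ContinuousOn.div (by fun_prop) (by fun_prop) fun z hz => (hh.sin_pos hz).ne'

theorem auxB_of_nonpos {y : ℝ} (hy : y ≤ 0) : auxB h y = 0 := by simp [auxB, hy]

theorem IsProfile.auxB_of_pos (hh : IsProfile h) {y : ℝ} (hy : 0 < y) :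
    auxB h y = Real.exp (-∫ z in y..1, Real.cot (h z)) := by
  unfold auxB
  rw [if_neg (not_le.2 hy)]
  split_ifs with h1
  · rfl
  · have : ∫ z in y..1, Real.cot (h z) = 0 := by
      rw [intervalIntegral.integral_congr (g := fun _ => (0 : ℝ))]
      · simp
      · intro z hz
        rw [uIcc_of_ge (not_lt.1 h1)] at hz
        simp [hh.eq_pi_div_two z hz.1, Real.cot_eq_cos_div_sin]
    simp [this]

theorem IsProfile.auxB_pos (hh : IsProfile h) {y : ℝ} (hy : 0 < y) : 0 < auxB h y := by
  rw [hh.auxB_of_pos hy]; exact Real.exp_pos _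

theorem IsProfile.auxB_nonneg (hh : IsProfile h) (y : ℝ) : 0 ≤ auxB h y := by
  rcases le_or_gt y 0 with hy | hy
  · rw [auxB_of_nonpos hy]
  · exact (hh.auxB_pos hy).le

theorem IsProfile.hasDerivAt_auxB_of_pos (hh : IsProfile h) {y : ℝ} (hy : 0 < y) :
    HasDerivAt (auxB h) (Real.cot (h y) * auxB h y) y := by
  have hI : IntervalIntegrable (fun z => Real.cot (h z)) volume y 1 :=
    (hh.continuousOn_cot.mono fun z hz => by
      have : min y 1 ≤ z := hz.1
      exact lt_of_lt_of_le (lt_min hy one_pos) this).intervalIntegrable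
  have hc : ContinuousAt (fun z => Real.cot (h z)) y :=
    hh.continuousOn_cot.continuousAt (Ioi_mem_nhds hy)
  have hm : StronglyMeasurableAtFilter (fun z => Real.cot (h z)) (𝓝 y) volume :=
    hh.continuousOn_cot.stronglyMeasurableAtFilter isOpen_Ioi y hy
  have := (intervalIntegral.integral_hasDerivAt_left hI hm hc).neg.exp
  have h2 : auxB h =ᶠ[𝓝 y] fun u => Real.exp (-∫ z in u..1, Real.cot (h z)) := by
    filter_upwards [Ioi_mem_nhds hy] with u hu using hh.auxB_of_pos hu
  rw [hh.auxB_of_pos hy]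
  convert! this.congr_of_eventuallyEq h2 using 1
  simp [mul_comm]

theorem IsProfile.hasDerivAt_sin (hh : IsProfile h) (y : ℝ) :
    HasDerivAt (fun z => Real.sin (h z)) (Real.cos (h y) * deriv h y) y :=
  (hh.smooth.differentiable (by simp) y).hasDerivAt.sin

theorem IsProfile.deriv_zero (hh : IsProfile h) : deriv h 0 = 0 :=
  deriv_eq_zero_of_eq_zero_nonpos (hh.smooth.differentiable (by simp)) hh.eq_zero le_rfl

theorem IsProfile.hasDerivAt_auxB_div_pow (hh : IsProfile h) (n : ℕ) {y : ℝ} (hy : 0 < y) :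
    HasDerivAt (fun z => auxB h z / Real.sin (h z) ^ n)
      (auxB h y / Real.sin (h y) ^ (n + 1) * (Real.cos (h y) * (1 - n * deriv h y))) y := by
  have hs := (hh.sin_pos hy).ne'
  convert! (hh.hasDerivAt_auxB_of_pos hy).div ((hh.hasDerivAt_sin y).pow n) (pow_ne_zero n hs)
    using 1
  rw [Real.cot_eq_cos_div_sin]
  rcases n with _ | n
  · simp; ring
  · simp only [Nat.add_sub_cancel, Pi.pow_apply]
    field_simp
    ring

/-- The sign of the derivative is that of `cos h · (1 - n h')`, which equals `1` at the origin
because `h` and `h'` vanish there. -/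
theorem IsProfile.eventually_monotone (hh : IsProfile h) (n : ℕ) :
    ∃ ε > 0, MonotoneOn (fun z => auxB h z / Real.sin (h z) ^ n) (Ioo 0 ε) := by
  have hc : Continuous fun y => Real.cos (h y) * (1 - n * deriv h y) := by
    have h1 := hh.smooth.continuous
    have h2 := hh.smooth.continuous_deriv (by simp)
    fun_prop
  have h0 : (0 : ℝ) < Real.cos (h 0) * (1 - n * deriv h 0) := by
    simp [hh.deriv_zero, hh.eq_zero 0 le_rfl]
  obtain ⟨ε, hε, hb⟩ := Metric.eventually_nhds_iff.1 (hc.continuousAt.eventually (lt_mem_nhds h0))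
  refine ⟨ε, hε, monotoneOn_of_deriv_nonneg (convex_Ioo 0 ε) ?_ ?_ ?_⟩
  · exact fun y hy => (hh.hasDerivAt_auxB_div_pow n hy.1).continuousAt.continuousWithinAt
  · rw [interior_Ioo]
    exact fun y hy => (hh.hasDerivAt_auxB_div_pow n hy.1).differentiableAt.differentiableWithinAt
  · rw [interior_Ioo]
    intro y hy
    rw [(hh.hasDerivAt_auxB_div_pow n hy.1).deriv]
    have := @hb y (by rw [Real.dist_eq, sub_zero, abs_of_pos hy.1]; exact hy.2)
    have h1 := (hh.sin_pos hy.1).le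
    have h2 := hh.auxB_nonneg y
    exact mul_nonneg (by positivity) this.le

theorem IsProfile.isLittleO_sin (hh : IsProfile h) :
    (fun y => Real.sin (h y)) =o[𝓝 0] fun y => y := by
  have := (hh.hasDerivAt_sin 0).isLittleO
  simpa [hh.deriv_zero, hh.eq_zero 0 le_rfl] using this

/-- The quotient is `B / sin^(n+1) h` times `sin h`: by monotonicity the first factor is bounded
near `0⁺`, and the second is `o(y)`. So `B` vanishes faster than every power of `sin h`. -/
theorem IsProfile.isLittleO_auxB_div_pow (hh : IsProfile h) (n : ℕ) :
    (fun z => auxB h z / Real.sin (h z) ^ n) =o[𝓝 0] fun y => y := by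
  obtain ⟨ε, hε, hm⟩ := hh.eventually_monotone (n + 1)
  refine Asymptotics.IsBigO.trans_isLittleO ?_ hh.isLittleO_sin
  refine Asymptotics.IsBigO.of_bound (auxB h (ε / 2) / Real.sin (h (ε / 2)) ^ (n + 1)) ?_
  filter_upwards [Iio_mem_nhds (half_pos hε)] with y hy
  rcases le_or_gt y 0 with h0 | h0
  · simp [auxB_of_nonpos h0, hh.eq_zero y h0]
  · have h1 := hm ⟨h0, by linarith [mem_Iio.1 hy]⟩ ⟨half_pos hε, by linarith⟩ (le_of_lt hy)
    have hs := hh.sin_pos h0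
    have hB := hh.auxB_nonneg y
    rw [Real.norm_of_nonneg (by positivity), Real.norm_of_nonneg hs.le]
    refine le_trans (le_of_eq ?_) (mul_le_mul_of_nonneg_right h1 hs.le)
    dsimp only
    field_simp
    ring

/-- Functions `a B / sin^n h` with smooth `a` are closed under differentiation, at the price of
raising `n` by one. This is what drives the induction for smoothness; at the origin the derivative
is zero by the `o(y)` estimate. -/
theorem IsProfile.hasDerivAt_mul_auxB_div_pow (hh : IsProfile h) (n : ℕ) {a : ℝ → ℝ}
    (ha : Differentiable ℝ a) (y : ℝ) :
    HasDerivAt (fun z => a z * (auxB h z / Real.sin (h z) ^ n))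
      ((deriv a y * Real.sin (h y) + a y * (Real.cos (h y) * (1 - n * deriv h y)))
        * (auxB h y / Real.sin (h y) ^ (n + 1))) y := by
  rcases lt_trichotomy y 0 with hy | rfl | hy
  · rw [auxB_of_nonpos hy.le]
    have : (fun z => a z * (auxB h z / Real.sin (h z) ^ n)) =ᶠ[𝓝 y] fun _ => 0 := by
      filter_upwards [Iio_mem_nhds hy] with z hz
      simp [auxB_of_nonpos (le_of_lt hz)]
    simpa using (hasDerivAt_const y (0 : ℝ)).congr_of_eventuallyEq this
  · rw [hasDerivAt_iff_isLittleO]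
    simp only [auxB_of_nonpos le_rfl, zero_div, mul_zero, sub_zero, smul_eq_mul]
    have h1 := (ha.continuous.continuousAt (x := 0)).norm.isBoundedUnder_le.isBigO_one ℝ
    simpa using h1.mul_isLittleO (hh.isLittleO_auxB_div_pow n)
  · convert! (ha y).hasDerivAt.mul (hh.hasDerivAt_auxB_div_pow n hy) using 1
    have := (hh.sin_pos hy).ne'
    field_simp
    ring

theorem IsProfile.contDiff_mul_auxB_div_pow (hh : IsProfile h) (m : ℕ) :
    ∀ (n : ℕ) (a : ℝ → ℝ), ContDiff ℝ ∞ a →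
      ContDiff ℝ m (fun z => a z * (auxB h z / Real.sin (h z) ^ n)) := by
  induction m with
  | zero =>
    intro n a ha
    refine contDiff_zero.2 (continuous_iff_continuousAt.2 fun y => ?_)
    exact (hh.hasDerivAt_mul_auxB_div_pow n (ha.differentiable (by simp)) y).continuousAt
  | succ m ih =>
    intro n a ha
    have hd := hh.hasDerivAt_mul_auxB_div_pow n (ha.differentiable (by simp))
    push_cast
    rw [contDiff_succ_iff_deriv]
    refine ⟨fun y => (hd y).differentiableAt, by simp, ?_⟩
    rw [funext fun y => (hd y).deriv]
    have h1 : ContDiff ℝ ∞ (deriv a) := (contDiff_infty_iff_deriv.1 ha).2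
    have h2 : ContDiff ℝ ∞ (deriv h) := (contDiff_infty_iff_deriv.1 hh.smooth).2
    have h3 := hh.smooth
    apply ih (n + 1)
    exact (h1.mul h3.sin).add (ha.mul (h3.cos.mul (contDiff_const.sub (contDiff_const.mul h2))))

theorem IsProfile.contDiff_auxB (hh : IsProfile h) (m : ℕ) : ContDiff ℝ m (auxB h) := by
  simpa using hh.contDiff_mul_auxB_div_pow m 0 (fun _ => 1) contDiff_const

end

/-! ### Riemann–Lebesgue and convolutions with sine and cosine -/

section

theorem tendsto_integral_mul_exp_atTop (g : ℝ → ℂ) :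
    Tendsto (fun M : ℝ => ∫ v, g v * Complex.exp (-(Complex.I * M * v))) atTop (𝓝 0) := by
  have h1 := (Real.tendsto_integral_exp_smul_cocompact g).comp
    -- The rescaling matches the Fourier character, which carries a factor `2π` in its exponent.
    (f := fun M : ℝ => M / (2 * Real.pi)) (x := atTop)
    ((tendsto_id.atTop_div_const (by positivity)).mono_right
      (by rw [cocompact_eq_atBot_atTop]; exact le_sup_right))
  refine h1.congr fun M => integral_congr_ae (ae_of_all _ fun v => ?_)
  have := Real.pi_ne_zero
  simp only [Circle.smul_def, Real.fourierChar_apply, smul_eq_mul]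
  rw [mul_comm]
  congr 2
  push_cast
  field_simp

theorem tendsto_intervalIntegral_mul_exp_atTop {f : ℝ → ℝ} (a b : ℝ) :
    Tendsto (fun M : ℝ => ∫ v in a..b, (f v : ℂ) * Complex.exp (-(Complex.I * M * v)))
      atTop (𝓝 0) := by
  have key : ∀ s : Set ℝ, MeasurableSet s →
      Tendsto (fun M : ℝ => ∫ v in s, (f v : ℂ) * Complex.exp (-(Complex.I * M * v)))
        atTop (𝓝 0) := by
    intro s hs
    refine (tendsto_integral_mul_exp_atTop (s.indicator fun v => (f v : ℂ))).congr fun M => ?_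
    rw [← integral_indicator hs]
    congr 1
    funext v
    by_cases hv : v ∈ s <;> simp [hv]
  simpa only [intervalIntegral, sub_zero] using
    (key _ measurableSet_Ioc).sub (key _ measurableSet_Ioc)

theorem exp_mul_integral_mul_exp {f : ℝ → ℝ} (hf : Continuous f) (K u a b : ℝ) :
    Complex.exp (Complex.I * K * u) * ∫ v in a..b, (f v : ℂ) * Complex.exp (-(Complex.I * K * v))
      = ((∫ v in a..b, f v * Real.cos (K * (u - v)) : ℝ) : ℂ)
        + ((∫ v in a..b, f v * Real.sin (K * (u - v)) : ℝ) : ℂ) * Complex.I := by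
  rw [← intervalIntegral.integral_const_mul, ← intervalIntegral.integral_ofReal,
    ← intervalIntegral.integral_ofReal, ← intervalIntegral.integral_mul_const,
    ← intervalIntegral.integral_add (Continuous.intervalIntegrable (by fun_prop) _ _)
      (Continuous.intervalIntegrable (by fun_prop) _ _)]
  congr 1
  funext v
  rw [mul_left_comm, ← Complex.exp_add, show Complex.I * K * u + -(Complex.I * K * v)
    = ((K * (u - v) : ℝ) : ℂ) * Complex.I by push_cast; ring, Complex.exp_mul_I]
  push_cast
  ring

/-- Riemann–Lebesgue lemma for the cosine transform on an interval, with a phase shift. -/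
theorem tendsto_intervalIntegral_mul_cos_atTop {f : ℝ → ℝ} (hf : Continuous f) (u a b : ℝ) :
    Tendsto (fun M : ℝ => ∫ v in a..b, f v * Real.cos (M * (u - v))) atTop (𝓝 0) := by
  refine squeeze_zero_norm (fun M => ?_)
    (norm_zero (E := ℂ) ▸ (tendsto_intervalIntegral_mul_exp_atTop (f := f) a b).norm)
  have h2 := Complex.abs_re_le_norm (Complex.exp (Complex.I * M * u)
    * ∫ v in a..b, (f v : ℂ) * Complex.exp (-(Complex.I * M * v)))
  rw [norm_mul, exp_mul_integral_mul_exp hf, show Complex.I * M * u = ((M * u : ℝ) : ℂ) * Complex.I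
    by push_cast; ring, Complex.norm_exp_ofReal_mul_I, one_mul] at h2
  simpa using h2

theorem tendsto_intervalIntegral_mul_one_sub_cos_atTop {f : ℝ → ℝ} (hf : Continuous f)
    (u a b : ℝ) :
    Tendsto (fun M : ℝ => ∫ v in a..b, f v * (1 - Real.cos (M * (u - v)))) atTop
      (𝓝 (∫ v in a..b, f v)) := by
  have := (tendsto_const_nhds (x := ∫ v in a..b, f v)).sub
    (tendsto_intervalIntegral_mul_cos_atTop hf u a b)
  rw [sub_zero] at this
  refine this.congr fun M => ?_
  rw [← intervalIntegral.integral_sub (hf.intervalIntegrable _ _)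
    ((by fun_prop : Continuous fun v => f v * Real.cos (M * (u - v))).intervalIntegrable _ _)]
  simp only [mul_sub, mul_one]

/-- Convolution of `f`, cut off at `0`, with `cos (K ·)`. -/
def cosConv (f : ℝ → ℝ) (K y : ℝ) : ℝ := ∫ z in (0 : ℝ)..y, f z * Real.cos (K * (y - z))

/-- Convolution of `f`, cut off at `0`, with `sin (K ·)`. -/
def sinConv (f : ℝ → ℝ) (K y : ℝ) : ℝ := ∫ z in (0 : ℝ)..y, f z * Real.sin (K * (y - z))

variable {f : ℝ → ℝ}

theorem continuous_cosConv (hf : Continuous f) :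
    Continuous fun p : ℝ × ℝ => cosConv f p.1 p.2 := by
  unfold cosConv
  exact intervalIntegral.continuous_parametric_intervalIntegral_of_continuous
    (f := fun (p : ℝ × ℝ) z => f z * Real.cos (p.1 * (p.2 - z))) (by fun_prop) continuous_snd

theorem continuous_sinConv (hf : Continuous f) :
    Continuous fun p : ℝ × ℝ => sinConv f p.1 p.2 := by
  unfold sinConv
  exact intervalIntegral.continuous_parametric_intervalIntegral_of_continuous
    (f := fun (p : ℝ × ℝ) z => f z * Real.sin (p.1 * (p.2 - z))) (by fun_prop) continuous_snd

/-- The addition formula removes `y` from the integrands, so that the derivative in `y` needs only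
the fundamental theorem of calculus. -/
theorem cosConv_eq (hf : Continuous f) (K y : ℝ) : cosConv f K y =
    Real.cos (K * y) * (∫ z in (0 : ℝ)..y, f z * Real.cos (K * z))
      + Real.sin (K * y) * ∫ z in (0 : ℝ)..y, f z * Real.sin (K * z) := by
  rw [← intervalIntegral.integral_const_mul, ← intervalIntegral.integral_const_mul,
    ← intervalIntegral.integral_add (Continuous.intervalIntegrable (by fun_prop) _ _)
      (Continuous.intervalIntegrable (by fun_prop) _ _), cosConv]
  congr 1; funext z
  rw [mul_sub, Real.cos_sub]; ring

theorem sinConv_eq (hf : Continuous f) (K y : ℝ) : sinConv f K y =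
    Real.sin (K * y) * (∫ z in (0 : ℝ)..y, f z * Real.cos (K * z))
      - Real.cos (K * y) * ∫ z in (0 : ℝ)..y, f z * Real.sin (K * z) := by
  rw [← intervalIntegral.integral_const_mul, ← intervalIntegral.integral_const_mul,
    ← intervalIntegral.integral_sub (Continuous.intervalIntegrable (by fun_prop) _ _)
      (Continuous.intervalIntegrable (by fun_prop) _ _), sinConv]
  congr 1; funext z
  rw [mul_sub, Real.sin_sub]; ring

theorem hasDerivAt_integral_of_continuous {g : ℝ → ℝ} (hg : Continuous g) (y : ℝ) :
    HasDerivAt (fun u => ∫ z in (0 : ℝ)..u, g z) (g y) y :=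
  intervalIntegral.integral_hasDerivAt_right (hg.intervalIntegrable _ _)
    hg.aestronglyMeasurable.stronglyMeasurableAtFilter hg.continuousAt

theorem hasDerivAt_cosConv (hf : Continuous f) (K y : ℝ) :
    HasDerivAt (cosConv f K) (f y - K * sinConv f K y) y := by
  rw [funext (cosConv_eq hf K), sinConv_eq hf]
  have hK : HasDerivAt (fun y => K * y) K y := by simpa using (hasDerivAt_id y).const_mul K
  convert! (hK.cos.mul (hasDerivAt_integral_of_continuous
    (g := fun z => f z * Real.cos (K * z)) (by fun_prop) y)).add
    (hK.sin.mul (hasDerivAt_integral_of_continuous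
    (g := fun z => f z * Real.sin (K * z)) (by fun_prop) y)) using 1
  linear_combination (-f y) * Real.cos_sq_add_sin_sq (K * y)

theorem hasDerivAt_sinConv (hf : Continuous f) (K y : ℝ) :
    HasDerivAt (sinConv f K) (K * cosConv f K y) y := by
  rw [funext (sinConv_eq hf K), cosConv_eq hf]
  have hK : HasDerivAt (fun y => K * y) K y := by simpa using (hasDerivAt_id y).const_mul K
  convert! (hK.sin.mul (hasDerivAt_integral_of_continuous
    (g := fun z => f z * Real.cos (K * z)) (by fun_prop) y)).sub
    (hK.cos.mul (hasDerivAt_integral_of_continuous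
    (g := fun z => f z * Real.sin (K * z)) (by fun_prop) y)) using 1
  ring

/-- Integration by parts: the boundary term at `0` vanishes with `f`, the one at `y` with the sine.
In the companion identity `mul_sinConv_eq` the term at `y` survives as `f y`. -/
theorem mul_cosConv_eq (hf : ContDiff ℝ 1 f) (h0 : f 0 = 0) (K y : ℝ) :
    K * cosConv f K y = sinConv (deriv f) K y := by
  have hc := hf.continuous
  have hc' := hf.continuous_deriv le_rfl
  have h1 := intervalIntegral.integral_eq_sub_of_hasDerivAt (a := 0) (b := y)
    (f := fun z => f z * Real.sin (K * (y - z)))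
    (f' := fun z => deriv f z * Real.sin (K * (y - z)) - K * (f z * Real.cos (K * (y - z))))
    (fun z _ => by
      have h2 : HasDerivAt (fun z => K * (y - z)) (-K) z := by
        simpa using ((hasDerivAt_id z).const_sub y).const_mul K
      convert! ((hf.differentiable one_ne_zero z).hasDerivAt).mul h2.sin using 1
      ring) (Continuous.intervalIntegrable (by fun_prop) _ _)
  rw [intervalIntegral.integral_sub (Continuous.intervalIntegrable (by fun_prop) _ _)
    (Continuous.intervalIntegrable (by fun_prop) _ _), intervalIntegral.integral_const_mul] at h1
  simp only [sub_self, mul_zero, Real.sin_zero, h0, zero_mul] at h1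
  unfold cosConv sinConv
  linarith

theorem mul_sinConv_eq (hf : ContDiff ℝ 1 f) (h0 : f 0 = 0) (K y : ℝ) :
    K * sinConv f K y = f y - cosConv (deriv f) K y := by
  have hc := hf.continuous
  have hc' := hf.continuous_deriv le_rfl
  have h1 := intervalIntegral.integral_eq_sub_of_hasDerivAt (a := 0) (b := y)
    (f := fun z => f z * Real.cos (K * (y - z)))
    (f' := fun z => deriv f z * Real.cos (K * (y - z)) + K * (f z * Real.sin (K * (y - z))))
    (fun z _ => by
      have h2 : HasDerivAt (fun z => K * (y - z)) (-K) z := by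
        simpa using ((hasDerivAt_id z).const_sub y).const_mul K
      convert! ((hf.differentiable one_ne_zero z).hasDerivAt).mul h2.cos using 1
      ring) (Continuous.intervalIntegrable (by fun_prop) _ _)
  rw [intervalIntegral.integral_add (Continuous.intervalIntegrable (by fun_prop) _ _)
    (Continuous.intervalIntegrable (by fun_prop) _ _), intervalIntegral.integral_const_mul] at h1
  simp only [sub_self, mul_zero, Real.cos_zero, h0, zero_mul, mul_one] at h1
  unfold cosConv sinConv
  linarith

theorem abs_sinConv_le (hf : Continuous f) (K : ℝ) {y : ℝ} (hy : 0 ≤ y) :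
    |sinConv f K y| ≤ ∫ z in (0 : ℝ)..y, |f z| := by
  unfold sinConv
  refine (intervalIntegral.abs_integral_le_integral_abs hy).trans ?_
  refine intervalIntegral.integral_mono_on hy (Continuous.intervalIntegrable (by fun_prop) _ _)
    (Continuous.intervalIntegrable (by fun_prop) _ _) fun z _ => ?_
  rw [abs_mul]
  exact mul_le_of_le_one_right (abs_nonneg _) (Real.abs_sin_le_one _)

theorem integrableOn_Ioi_of_norm_le_div_sq {g : ℝ → ℝ} (hg : Continuous g) {c : ℝ}
    (hb : ∀ K, 0 < K → |g K| ≤ c / K ^ 2) : IntegrableOn g (Ioi 0) := by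
  rw [← Ioc_union_Ioi_eq_Ioi (zero_le_one' ℝ)]
  refine IntegrableOn.union hg.integrableOn_Ioc ?_
  have h1 : IntegrableOn (fun x : ℝ => c * x ^ (-2 : ℝ)) (Ioi 1) :=
    (integrableOn_Ioi_rpow_of_lt (by norm_num) one_pos).const_mul c
  refine Integrable.mono' h1 hg.aestronglyMeasurable.restrict ?_
  filter_upwards [ae_restrict_mem measurableSet_Ioi] with K hK
  have hK' : (0 : ℝ) < K := one_pos.trans hK
  rw [Real.norm_eq_abs, Real.rpow_neg hK'.le, ← div_eq_mul_inv]
  exact_mod_cast hb K hK'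

theorem integral_integral_swap_of_continuous {F : ℝ → ℝ → ℝ} (hF : Continuous F.uncurry)
    (a b c d : ℝ) :
    ∫ x in a..b, ∫ y in c..d, F x y = ∫ y in c..d, ∫ x in a..b, F x y := by
  refine intervalIntegral_intervalIntegral_swap ?_
  exact (hF.continuousOn.integrableOn_compact (isCompact_uIcc.prod isCompact_uIcc)).mono_set
    (prod_mono uIoc_subset_uIcc uIoc_subset_uIcc)

theorem integral_mul_sin (s M : ℝ) : ∫ K in (0 : ℝ)..M, s * Real.sin (K * s)
    = 1 - Real.cos (M * s) := by
  have := intervalIntegral.integral_eq_sub_of_hasDerivAt (a := 0) (b := M)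
    (f := fun K => -Real.cos (K * s)) (f' := fun K => s * Real.sin (K * s))
    (fun z _ => by
      convert! ((hasDerivAt_id z).mul_const s).cos.neg using 1
      simp; ring) (Continuous.intervalIntegrable (by fun_prop) _ _)
  rw [this]; simp; ring

end

/-! ### The wave kernel and its integral over frequencies -/

section

/-- `B' (B * sin (K ·)) - K B (B * cos (K ·))`, with convolutions over `(0, u)`. -/
def waveKernel (B : ℝ → ℝ) (K u : ℝ) : ℝ :=
  deriv B u * sinConv B K u - K * B u * cosConv B K u

/-- The divided Wronskian `(B'(u) B(z) - B(u) B'(z)) / (u - z)`, extended to the diagonal. -/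
def wronskQuot (B : ℝ → ℝ) (u z : ℝ) : ℝ :=
  ∫ θ in (0 : ℝ)..1,
    (deriv (deriv B) (z + θ * (u - z)) * B z - deriv B (z + θ * (u - z)) * deriv B z)

/-- Integral over `0 < K < ∞` of `waveKernel B K u`. -/
def waveTotal (B : ℝ → ℝ) (u : ℝ) : ℝ := ∫ z in (0 : ℝ)..u, wronskQuot B u z

variable {B : ℝ → ℝ}

theorem contDiff_deriv {n : ℕ} (hB : ContDiff ℝ (n + 1) B) : ContDiff ℝ n (deriv B) :=
  (contDiff_succ_iff_deriv.1 hB).2.2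

theorem continuous_waveKernel (hB : ContDiff ℝ 1 B) :
    Continuous fun p : ℝ × ℝ => waveKernel B p.1 p.2 := by
  have h1 := hB.continuous
  have h2 := hB.continuous_deriv le_rfl
  have h3 := continuous_sinConv h1
  have h4 := continuous_cosConv h1
  unfold waveKernel
  fun_prop

theorem continuous_wronskQuot (hB : ContDiff ℝ 2 B) :
    Continuous fun p : ℝ × ℝ => wronskQuot B p.1 p.2 := by
  have h1 := hB.continuous
  have h2 := hB.continuous_deriv one_le_two
  have h3 := (contDiff_deriv (n := 1) hB).continuous_deriv le_rfl
  unfold wronskQuot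
  exact intervalIntegral.continuous_parametric_intervalIntegral_of_continuous' (f :=
    fun (p : ℝ × ℝ) θ => deriv (deriv B) (p.2 + θ * (p.1 - p.2)) * B p.2
      - deriv B (p.2 + θ * (p.1 - p.2)) * deriv B p.2) (by fun_prop) 0 1

theorem continuous_waveTotal (hB : ContDiff ℝ 2 B) : Continuous (waveTotal B) :=
  intervalIntegral.continuous_parametric_intervalIntegral_of_continuous
    (continuous_wronskQuot hB) continuous_id

/-- With `z` frozen in one slot, the Wronskian vanishes at `θ = 0`; integrating its derivative along
the segment from `z` to `u` gives the claim. -/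
theorem sub_mul_wronskQuot (hB : ContDiff ℝ 2 B) (u z : ℝ) :
    (u - z) * wronskQuot B u z = deriv B u * B z - B u * deriv B z := by
  have h2 := hB.continuous_deriv one_le_two
  have h3 := (contDiff_deriv (n := 1) hB).continuous_deriv le_rfl
  have h1 := intervalIntegral.integral_eq_sub_of_hasDerivAt (a := 0) (b := 1)
    (f := fun θ => deriv B (z + θ * (u - z)) * B z - B (z + θ * (u - z)) * deriv B z)
    (f' := fun θ => (u - z) * (deriv (deriv B) (z + θ * (u - z)) * B z
      - deriv B (z + θ * (u - z)) * deriv B z))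
    (fun θ _ => by
      have hl : HasDerivAt (fun θ => z + θ * (u - z)) (u - z) θ := by
        simpa using ((hasDerivAt_id θ).mul_const (u - z)).const_add z
      have e1 := ((contDiff_deriv (n := 1) hB).differentiable one_ne_zero
        (z + θ * (u - z))).hasDerivAt.comp θ hl
      have e2 := (hB.differentiable two_ne_zero (z + θ * (u - z))).hasDerivAt.comp θ hl
      convert! (e1.mul_const (B z)).sub (e2.mul_const (deriv B z)) using 1
      ring) (Continuous.intervalIntegrable (by fun_prop) _ _)
  rw [intervalIntegral.integral_const_mul] at h1
  rw [wronskQuot, h1]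
  simp
  ring

/-- Integration by parts turns `K` times the cosine convolution of `B` into the sine convolution of
`B'`, so both terms of the kernel become sine transforms and combine to the Wronskian. The exposed
factor `(u - z) sin (K(u - z))` has the explicit antiderivative `-cos (K(u - z))` in `K`. -/
theorem waveKernel_eq_integral (hB : ContDiff ℝ 2 B) (h0 : B 0 = 0) (K u : ℝ) :
    waveKernel B K u
      = ∫ z in (0 : ℝ)..u, wronskQuot B u z * ((u - z) * Real.sin (K * (u - z))) := by
  have hc := hB.continuous
  have hc' := hB.continuous_deriv one_le_two
  rw [waveKernel, mul_right_comm, mul_cosConv_eq (hB.of_le one_le_two) h0, sinConv, sinConv,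
    mul_comm _ (B u), ← intervalIntegral.integral_const_mul, ← intervalIntegral.integral_const_mul,
    ← intervalIntegral.integral_sub (Continuous.intervalIntegrable (by fun_prop) _ _)
      (Continuous.intervalIntegrable (by fun_prop) _ _)]
  congr 1
  funext z
  linear_combination (-Real.sin (K * (u - z))) * sub_mul_wronskQuot hB u z

theorem integral_waveKernel (hB : ContDiff ℝ 2 B) (h0 : B 0 = 0) (M u : ℝ) :
    ∫ K in (0 : ℝ)..M, waveKernel B K u
      = ∫ z in (0 : ℝ)..u, wronskQuot B u z * (1 - Real.cos (M * (u - z))) := by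
  have hk := continuous_wronskQuot hB
  simp only [waveKernel_eq_integral hB h0]
  rw [integral_integral_swap_of_continuous]
  · simp only [← integral_mul_sin, intervalIntegral.integral_const_mul]
  · have : Continuous fun p : ℝ × ℝ => wronskQuot B u p.2 :=
      hk.comp (continuous_const.prodMk continuous_snd)
    simp only [Function.uncurry_def]
    fun_prop

theorem tendsto_integral_waveKernel (hB : ContDiff ℝ 2 B) (h0 : B 0 = 0) (u : ℝ) :
    Tendsto (fun M => ∫ K in (0 : ℝ)..M, waveKernel B K u) atTop (𝓝 (waveTotal B u)) := by
  simp only [integral_waveKernel hB h0]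
  exact tendsto_intervalIntegral_mul_one_sub_cos_atTop
    ((continuous_wronskQuot hB).comp (continuous_const.prodMk continuous_id)) u 0 u

/-- Dominated convergence in `u` after exchanging the integrals; the bound comes from `|1 - cos| ≤
2`, uniformly in `M`. -/
theorem tendsto_integral_integral_waveKernel (hB : ContDiff ℝ 2 B) (h0 : B 0 = 0) {y : ℝ}
    (hy : 0 ≤ y) :
    Tendsto (fun M => ∫ K in (0 : ℝ)..M, ∫ u in (0 : ℝ)..y, waveKernel B K u) atTop
      (𝓝 (∫ u in (0 : ℝ)..y, waveTotal B u)) := by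
  have hk := continuous_wronskQuot hB
  have hP := continuous_waveKernel (hB.of_le one_le_two)
  have hc : Continuous fun u => ∫ z in (0 : ℝ)..u, |wronskQuot B u z| * 2 :=
    intervalIntegral.continuous_parametric_intervalIntegral_of_continuous
      (f := fun u z => |wronskQuot B u z| * 2) (by simp only [Function.uncurry_def]; fun_prop)
      continuous_id
  simp_rw [fun M => integral_integral_swap_of_continuous (F := waveKernel B) hP 0 M 0 y]
  refine intervalIntegral.tendsto_integral_filter_of_dominated_convergence
    (fun u => ∫ z in (0 : ℝ)..u, |wronskQuot B u z| * 2) ?_ ?_ (hc.intervalIntegrable _ _) ?_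
  · refine Eventually.of_forall fun M => Continuous.aestronglyMeasurable ?_
    exact intervalIntegral.continuous_parametric_intervalIntegral_of_continuous'
      (f := fun u K => waveKernel B K u) (hP.comp continuous_swap) 0 M
  · refine Eventually.of_forall fun M => ae_of_all _ fun u hu => ?_
    rw [uIoc_of_le hy] at hu
    have hku : Continuous (wronskQuot B u) := hk.comp (continuous_const.prodMk continuous_id)
    rw [integral_waveKernel hB h0]
    refine (intervalIntegral.abs_integral_le_integral_abs hu.1.le).trans ?_
    refine intervalIntegral.integral_mono_on hu.1.le
      (Continuous.intervalIntegrable (by fun_prop) _ _)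
      (Continuous.intervalIntegrable (by fun_prop) _ _) fun z _ => ?_
    rw [abs_mul]
    refine mul_le_mul_of_nonneg_left ?_ (abs_nonneg _)
    rw [abs_le]
    constructor <;> linarith [Real.neg_one_le_cos (M * (u - z)), Real.cos_le_one (M * (u - z))]
  · exact ae_of_all _ fun u _ => tendsto_integral_waveKernel hB h0 u

/-- The system `C' = B - K S`, `S' = K C` makes the quadratic terms cancel on differentiating the
left side, and only minus the kernel remains. Both sides vanish at `y = 0`. -/
theorem mul_sq_add_sq_sub (hB : ContDiff ℝ 1 B) (K y : ℝ) :
    K * (cosConv B K y ^ 2 + sinConv B K y ^ 2) - B y * sinConv B K y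
      = -∫ u in (0 : ℝ)..y, waveKernel B K u := by
  have hP : Continuous (waveKernel B K) :=
    (continuous_waveKernel hB).comp (continuous_const.prodMk continuous_id)
  have h1 := intervalIntegral.integral_eq_sub_of_hasDerivAt (a := 0) (b := y)
    (f := fun y => -(K * (cosConv B K y ^ 2 + sinConv B K y ^ 2) - B y * sinConv B K y))
    (f' := waveKernel B K) (fun u _ => by
      have hC := hasDerivAt_cosConv hB.continuous K u
      have hS := hasDerivAt_sinConv hB.continuous K u
      have hb := (hB.differentiable one_ne_zero u).hasDerivAt
      convert! ((((hC.pow 2).add (hS.pow 2)).const_mul K).sub (hb.mul hS)).neg using 1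
      rw [waveKernel]; simp; ring) (hP.intervalIntegrable _ _)
  rw [h1]
  simp [cosConv, sinConv]

/-- Coefficient in the bound of `waveKernel B K u` by a multiple of `1 / K ^ 2`. -/
def waveBound (B : ℝ → ℝ) (u : ℝ) : ℝ :=
  |B u| * (∫ z in (0 : ℝ)..u, |deriv (deriv (deriv B)) z|)
    + |deriv B u| * ∫ z in (0 : ℝ)..u, |deriv (deriv B) z|

theorem continuous_waveBound (hB : ContDiff ℝ 3 B) : Continuous (waveBound B) := by
  have hB1 := contDiff_deriv (n := 2) hB
  have hB2 := contDiff_deriv (n := 1) hB1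
  have c0 := hB.continuous
  have c1 := hB1.continuous
  have c2 := hB2.continuous
  have c3 := hB2.continuous_deriv le_rfl
  unfold waveBound
  have e1 : Continuous fun u => ∫ z in (0 : ℝ)..u, |deriv (deriv (deriv B)) z| :=
    continuous_iff_continuousAt.2 fun u =>
      (hasDerivAt_integral_of_continuous (by fun_prop) u).continuousAt
  have e2 : Continuous fun u => ∫ z in (0 : ℝ)..u, |deriv (deriv B) z| :=
    continuous_iff_continuousAt.2 fun u =>
      (hasDerivAt_integral_of_continuous (by fun_prop) u).continuousAt
  fun_prop

theorem abs_waveKernel_le (hB : ContDiff ℝ 3 B) (h0 : ∀ y, y ≤ 0 → B y = 0) {K u : ℝ}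
    (hK : 0 < K) (hu : 0 ≤ u) : |waveKernel B K u| ≤ waveBound B u / K ^ 2 := by
  have hB1 := contDiff_deriv (n := 2) hB
  have hB2 := contDiff_deriv (n := 1) hB1
  have z1 : ∀ y, y ≤ 0 → deriv B y = 0 := fun y hy =>
    deriv_eq_zero_of_eq_zero_nonpos (hB.differentiable (by simp)) h0 hy
  have z2 : ∀ y, y ≤ 0 → deriv (deriv B) y = 0 := fun y hy =>
    deriv_eq_zero_of_eq_zero_nonpos (hB1.differentiable (by simp)) z1 hy
  have i1 := mul_cosConv_eq (hB.of_le (by norm_num)) (h0 0 le_rfl) K u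
  have i2 := mul_sinConv_eq (hB.of_le (by norm_num)) (h0 0 le_rfl) K u
  have i3 := mul_cosConv_eq (f := deriv B) (hB1.of_le (by norm_num)) (z1 0 le_rfl) K u
  have i4 := mul_sinConv_eq (f := deriv B) (hB1.of_le (by norm_num)) (z1 0 le_rfl) K u
  have i5 := mul_cosConv_eq (f := deriv (deriv B)) hB2 (z2 0 le_rfl) K u
  -- Integrating each term of the kernel by parts produces a contribution `K B B'`, and the two
  -- cancel. Without this cancellation the decay would only be of order `1 / K`.
  have key : waveKernel B K u * K ^ 2 = B u * sinConv (deriv (deriv (deriv B))) K u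
      - deriv B u * sinConv (deriv (deriv B)) K u := by
    unfold waveKernel
    linear_combination (deriv B u * K) * i2 - K ^ 2 * B u * i1 - (B u * K) * i4
      - deriv B u * i3 + B u * i5
  rw [le_div_iff₀ (by positivity), ← abs_of_pos (show 0 < K ^ 2 by positivity), ← abs_mul, key]
  refine (abs_sub _ _).trans ?_
  rw [abs_mul, abs_mul]
  exact add_le_add
    (mul_le_mul_of_nonneg_left (abs_sinConv_le (hB2.continuous_deriv le_rfl) K hu) (abs_nonneg _))
    (mul_le_mul_of_nonneg_left (abs_sinConv_le hB2.continuous K hu) (abs_nonneg _))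

theorem integrableOn_waveKernel (hB : ContDiff ℝ 3 B) (h0 : ∀ y, y ≤ 0 → B y = 0) {u : ℝ}
    (hu : 0 ≤ u) : IntegrableOn (fun K => waveKernel B K u) (Ioi 0) :=
  integrableOn_Ioi_of_norm_le_div_sq
    ((continuous_waveKernel (hB.of_le (by norm_num))).comp (continuous_id.prodMk continuous_const))
    fun _ hK => abs_waveKernel_le hB h0 hK hu

theorem integrableOn_integral_waveKernel (hB : ContDiff ℝ 3 B) (h0 : ∀ y, y ≤ 0 → B y = 0)
    {y : ℝ} (hy : 0 ≤ y) :
    IntegrableOn (fun K => ∫ u in (0 : ℝ)..y, waveKernel B K u) (Ioi 0) := by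
  have hP := continuous_waveKernel (hB.of_le (by norm_num : (1 : WithTop ℕ∞) ≤ 3))
  refine integrableOn_Ioi_of_norm_le_div_sq
    (intervalIntegral.continuous_parametric_intervalIntegral_of_continuous' hP 0 y)
    (c := ∫ u in (0 : ℝ)..y, waveBound B u) fun K hK => ?_
  have hPK : Continuous (waveKernel B K) := hP.comp (continuous_const.prodMk continuous_id)
  have hb := continuous_waveBound hB
  refine (intervalIntegral.abs_integral_le_integral_abs hy).trans ?_
  rw [← intervalIntegral.integral_div]
  exact intervalIntegral.integral_mono_on hy (Continuous.intervalIntegrable (by fun_prop) _ _)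
    (Continuous.intervalIntegrable (by fun_prop) _ _) fun u hu => abs_waveKernel_le hB h0 hK hu.1

/-- The absolutely convergent integral is also the limit of the truncated ones, which
Riemann–Lebesgue has already computed. -/
theorem setIntegral_waveKernel (hB : ContDiff ℝ 3 B) (h0 : ∀ y, y ≤ 0 → B y = 0) {u : ℝ}
    (hu : 0 ≤ u) : ∫ K in Ioi (0 : ℝ), waveKernel B K u = waveTotal B u :=
  tendsto_nhds_unique
    (intervalIntegral_tendsto_integral_Ioi 0 (integrableOn_waveKernel hB h0 hu) tendsto_id)
    (tendsto_integral_waveKernel (hB.of_le (by norm_num)) (h0 0 le_rfl) u)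

theorem setIntegral_integral_waveKernel (hB : ContDiff ℝ 3 B) (h0 : ∀ y, y ≤ 0 → B y = 0)
    {y : ℝ} (hy : 0 ≤ y) :
    ∫ K in Ioi (0 : ℝ), ∫ u in (0 : ℝ)..y, waveKernel B K u
      = ∫ u in (0 : ℝ)..y, waveTotal B u :=
  tendsto_nhds_unique
    (intervalIntegral_tendsto_integral_Ioi 0 (integrableOn_integral_waveKernel hB h0 hy)
      tendsto_id)
    (tendsto_integral_integral_waveKernel (hB.of_le (by norm_num)) (h0 0 le_rfl) hy)

end

/-! ### The mode function and the two frequency integrands -/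

section

variable {h : ℝ → ℝ}

theorem IsProfile.deriv_auxB_of_pos (hh : IsProfile h) {y : ℝ} (hy : 0 < y) :
    deriv (auxB h) y = Real.cot (h y) * auxB h y := (hh.hasDerivAt_auxB_of_pos hy).deriv

theorem IsProfile.continuous_auxB (hh : IsProfile h) : Continuous (auxB h) :=
  (hh.contDiff_auxB 0).continuous

theorem IsProfile.deriv_auxB_nonneg (hh : IsProfile h) (y : ℝ) : 0 ≤ deriv (auxB h) y := by
  rcases le_or_gt y 0 with hy | hy
  · exact (deriv_eq_zero_of_eq_zero_nonpos ((hh.contDiff_auxB 1).differentiable one_ne_zero)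
      (fun _ => auxB_of_nonpos) hy).ge
  · rw [hh.deriv_auxB_of_pos hy, Real.cot_eq_cos_div_sin]
    have h1 := hh.sin_pos hy
    have h2 : 0 ≤ Real.cos (h y) := by
      rcases lt_or_ge y 1 with h1 | h1
      · exact (Real.cos_pos_of_mem_Ioo ⟨by linarith [hh.pos y hy h1, Real.pi_pos],
          hh.lt_pi_div_two y hy h1⟩).le
      · simp [hh.eq_pi_div_two y h1]
    have h3 := hh.auxB_nonneg y
    positivity

theorem IsProfile.cos_pos (hh : IsProfile h) {y : ℝ} (hy : y < 1) : 0 < Real.cos (h y) := by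
  rcases le_or_gt y 0 with h0 | h0
  · simp [hh.eq_zero y h0]
  · exact Real.cos_pos_of_mem_Ioo ⟨by linarith [hh.pos y h0 hy, Real.pi_pos],
      hh.lt_pi_div_two y h0 hy⟩

/-- The differential equation `B' = cot h · B`, put in a form that is regular at the origin: `tan h`
is smooth on all of `y < 1`, whereas `cot h` blows up as `y → 0⁺`. -/
theorem IsProfile.auxB_eq_tan_mul (hh : IsProfile h) {y : ℝ} (hy : y < 1) :
    auxB h y = Real.tan (h y) * deriv (auxB h) y := by
  rcases le_or_gt y 0 with h0 | h0
  · simp [auxB_of_nonpos h0, hh.eq_zero y h0]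
  · rw [hh.deriv_auxB_of_pos h0, Real.cot_eq_cos_div_sin, Real.tan_eq_sin_div_cos]
    have := (hh.sin_pos h0).ne'
    have := (hh.cos_pos hy).ne'
    field_simp

theorem IsProfile.contDiffOn_tan (hh : IsProfile h) :
    ContDiffOn ℝ ∞ (fun y => Real.tan (h y)) (Iio 1) := fun y hy =>
  ((Real.contDiffAt_tan.2 (hh.cos_pos hy).ne').comp y hh.smooth.contDiffAt).contDiffWithinAt

theorem IsProfile.integral_deriv_auxB (hh : IsProfile h) (y : ℝ) :
    ∫ z in (0 : ℝ)..y, deriv (auxB h) z = auxB h y := by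
  have h1 := hh.contDiff_auxB 1
  rw [intervalIntegral.integral_eq_sub_of_hasDerivAt
    (fun z _ => (h1.differentiable one_ne_zero z).hasDerivAt)
    ((h1.continuous_deriv le_rfl).intervalIntegrable _ _), auxB_of_nonpos le_rfl, sub_zero]

/-- Derivatives of `tan h` of any order are small near `0`. -/
theorem IsProfile.exists_abs_iteratedDeriv_tan_le (hh : IsProfile h) (n : ℕ) {ε : ℝ} (hε : 0 < ε) :
    ∃ δ > 0, δ < 1 ∧ ∀ y, |y| < δ → |iteratedDeriv n (fun y => Real.tan (h y)) y| ≤ ε := by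
  set T := fun y => Real.tan (h y) with hT
  have hc : ContinuousAt (iteratedDeriv n T) 0 := by
    have h1 := hh.contDiffOn_tan.continuousOn_iteratedDerivWithin (m := n) (mod_cast le_top)
      isOpen_Iio.uniqueDiffOn
    exact (h1.congr (iteratedDerivWithin_of_isOpen isOpen_Iio).symm).continuousAt
      (Iio_mem_nhds one_pos)
  have hneg : ∀ y < 0, iteratedDeriv n T y = 0 := fun y hy => by
    have : T =ᶠ[𝓝 y] fun _ => 0 := by
      filter_upwards [Iio_mem_nhds hy] with z hz
      simp [hT, hh.eq_zero z (le_of_lt hz)]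
    rw [this.iteratedDeriv_eq n]
    simp
  -- The derivative is continuous at `0` and vanishes identically to the left.
  have h0 : iteratedDeriv n T 0 = 0 := by
    refine tendsto_nhds_unique (hc.tendsto.mono_left (nhdsWithin_le_nhds (s := Iio 0))) ?_
    exact tendsto_const_nhds.congr'
      (eventually_nhdsWithin_of_forall fun y hy => (hneg y hy).symm)
  obtain ⟨δ, hδ, hb⟩ := Metric.continuousAt_iff.1 hc ε hε
  refine ⟨min δ (1 / 2), by positivity, by linarith [min_le_right δ (1 / 2)], fun y hy => ?_⟩
  have := hb (x := y) (by
    rw [Real.dist_eq, sub_zero]; exact hy.trans_le (min_le_left _ _))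
  rw [h0, Real.dist_eq, sub_zero] at this
  exact this.le

theorem IsProfile.iteratedDeriv_tan_zero (hh : IsProfile h) (n : ℕ) :
    iteratedDeriv n (fun y => Real.tan (h y)) 0 = 0 := by
  refine abs_nonpos_iff.1 (le_of_forall_pos_le_add fun ε hε => ?_)
  obtain ⟨δ, hδ, -, hb⟩ := hh.exists_abs_iteratedDeriv_tan_le n hε
  rw [zero_add]
  exact hb 0 (by simpa using hδ)

theorem IsProfile.abs_tan_sub_tan_le (hh : IsProfile h) {ε δ : ℝ} (hδ : δ < 1)
    (hb : ∀ y, |y| < δ → |deriv (fun y => Real.tan (h y)) y| ≤ ε) {u z : ℝ} (hu : |u| < δ)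
    (hz : |z| < δ) : |Real.tan (h u) - Real.tan (h z)| ≤ ε * |u - z| := by
  have := (convex_Ioo (-δ) δ).norm_image_sub_le_of_norm_deriv_le (𝕜 := ℝ) (C := ε)
    (f := fun y => Real.tan (h y)) (x := z) (y := u)
    (fun y hy => (hh.contDiffOn_tan.contDiffAt
      (Iio_mem_nhds (hy.2.trans hδ))).differentiableAt (by simp))
    (fun y hy => hb y (abs_lt.2 hy)) (abs_lt.1 hz) (abs_lt.1 hu)
  simpa using this

/-- Near the origin `B = T B' ≤ ε y B'` on `[0, y]` because `T'` is small there, and `B'` integrates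
to `B`. -/
theorem IsProfile.integral_auxB_le (hh : IsProfile h) {ε : ℝ} (hε : 0 < ε) :
    ∀ᶠ y in 𝓝[>] (0 : ℝ), ∫ z in (0 : ℝ)..y, auxB h z ≤ ε * y * auxB h y := by
  obtain ⟨δ, hδ, hδ1, hb⟩ := hh.exists_abs_iteratedDeriv_tan_le 1 hε
  rw [iteratedDeriv_one] at hb
  filter_upwards [Ioo_mem_nhdsGT hδ] with y hy
  rw [← hh.integral_deriv_auxB y, ← intervalIntegral.integral_const_mul]
  have h1 := (hh.contDiff_auxB 1).continuous_deriv le_rfl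
  have h0 := hh.continuous_auxB
  refine intervalIntegral.integral_mono_on hy.1.le (Continuous.intervalIntegrable (by fun_prop) _ _)
    (Continuous.intervalIntegrable (by fun_prop) _ _) fun z hz => ?_
  rw [hh.auxB_eq_tan_mul (by linarith [hz.2, hy.2])]
  refine mul_le_mul_of_nonneg_right ?_ (hh.deriv_auxB_nonneg z)
  have := hh.abs_tan_sub_tan_le hδ1 hb (u := z) (z := 0)
    (abs_lt.2 ⟨by linarith [hz.1], by linarith [hz.2, hy.2]⟩) (by simpa using hδ)
  rw [hh.eq_zero 0 le_rfl, Real.tan_zero, sub_zero, sub_zero, abs_of_nonneg hz.1] at this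
  exact (le_abs_self _).trans (this.trans (mul_le_mul_of_nonneg_left hz.2 hε.le))

theorem integral_mul_exp_eq {B : ℝ → ℝ} (hB : Continuous B) (K y : ℝ) :
    ∫ z in (0 : ℝ)..y, (B z : ℂ) * Complex.exp (-(Complex.I * K * z))
      = Complex.exp (-(Complex.I * K * y)) * (cosConv B K y + sinConv B K y * Complex.I) := by
  rw [cosConv, sinConv, ← exp_mul_integral_mul_exp hB, ← mul_assoc, ← Complex.exp_add]
  simp

theorem IsProfile.modeR_of_pos (hh : IsProfile h) (K : ℝ) {y : ℝ} (hy : 0 < y) :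
    modeR h K y = -Complex.exp (-(Complex.I * K * y))
      * (((1 - 2 * K * sinConv (auxB h) K y / auxB h y : ℝ) : ℂ)
        + ((2 * K * cosConv (auxB h) K y / auxB h y : ℝ) : ℂ) * Complex.I) := by
  rw [modeR, if_neg (not_le.2 hy), integral_mul_exp_eq hh.continuous_auxB]
  have hB : (auxB h y : ℂ) ≠ 0 := by exact_mod_cast (hh.auxB_pos hy).ne'
  push_cast
  field_simp
  ring_nf
  simp only [Complex.I_sq]
  ring

theorem hasDerivAt_neg_exp (K y : ℝ) :
    HasDerivAt (fun y : ℝ => -Complex.exp (-(Complex.I * K * y)))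
      (Complex.I * K * Complex.exp (-(Complex.I * K * y))) y := by
  have h1 : HasDerivAt (fun y : ℝ => -(Complex.I * K * (y : ℂ))) (-(Complex.I * K)) y := by
    convert! ((Complex.ofRealCLM.hasDerivAt (x := y)).const_mul (Complex.I * (K : ℂ))).neg using 1
    simp
  convert! h1.cexp.neg using 1
  ring

theorem IsProfile.hasDerivAt_modeR_of_pos (hh : IsProfile h) (K : ℝ) {y : ℝ} (hy : 0 < y) :
    HasDerivAt (modeR h K) (-(Complex.I * K * Complex.exp (-(Complex.I * K * y)))
      * (((1 - 2 * Real.cot (h y) * cosConv (auxB h) K y / auxB h y : ℝ) : ℂ)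
        + ((-(2 * Real.cot (h y) * sinConv (auxB h) K y / auxB h y) : ℝ) : ℂ) * Complex.I)) y := by
  have hc := hh.continuous_auxB
  have hB : (auxB h y : ℂ) ≠ 0 := by exact_mod_cast (hh.auxB_pos hy).ne'
  have hX : HasDerivAt (fun y : ℝ => ∫ z in (0 : ℝ)..y,
      (auxB h z : ℂ) * Complex.exp (-(Complex.I * K * z)))
      ((auxB h y : ℂ) * Complex.exp (-(Complex.I * K * y))) y := by
    have : Continuous fun z : ℝ => (auxB h z : ℂ) * Complex.exp (-(Complex.I * K * z)) := by
      fun_prop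
    exact intervalIntegral.integral_hasDerivAt_right (this.intervalIntegrable _ _)
      this.aestronglyMeasurable.stronglyMeasurableAtFilter this.continuousAt
  have hBd := (hh.hasDerivAt_auxB_of_pos hy).ofReal_comp
  have := (hasDerivAt_neg_exp K y).sub
    (((hasDerivAt_const y (2 * Complex.I * (K : ℂ))).div hBd hB).mul hX)
  refine (this.congr_of_eventuallyEq (f₁ := modeR h K) ?_).congr_deriv ?_
  · filter_upwards [Ioi_mem_nhds hy] with u hu
    rw [modeR, if_neg (not_le.2 hu)]
    rfl
  · simp only [Pi.div_apply]
    rw [integral_mul_exp_eq hc]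
    push_cast
    field_simp
    ring

theorem IsProfile.hasDerivAt_modeR_of_nonpos (hh : IsProfile h) (K : ℝ) {y : ℝ} (hy : y ≤ 0) :
    HasDerivAt (modeR h K) (Complex.I * K * Complex.exp (-(Complex.I * K * y))) y := by
  rcases hy.lt_or_eq with hy | rfl
  · refine (hasDerivAt_neg_exp K y).congr_of_eventuallyEq ?_
    filter_upwards [Iio_mem_nhds hy] with u hu
    rw [modeR, if_pos (le_of_lt hu)]
  -- Only the deviation from the incoming wave needs attention at the junction. It is at most `(2|K|
  -- / B) ∫ B`, hence `o(y)` by `IsProfile.integral_auxB_le`.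
  · have key : HasDerivAt (fun y => modeR h K y - -Complex.exp (-(Complex.I * K * y))) 0 0 := by
      rw [hasDerivAt_iff_isLittleO]
      simp only [modeR, le_refl, if_true, sub_self, sub_zero, smul_zero]
      refine Asymptotics.isLittleO_iff.2 fun ε hε => ?_
      -- The added `1` keeps the denominator positive also for `K = 0`.
      have hK : 0 < 2 * |K| + 1 := by positivity
      have := eventually_nhdsWithin_iff.1 (hh.integral_auxB_le (ε := ε / (2 * |K| + 1))
        (by positivity))
      filter_upwards [this] with y hy
      rcases le_or_gt y 0 with h0 | h0
      · simp only [if_pos h0, sub_self, norm_zero]; positivity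
      · have hB := hh.auxB_pos h0
        have hI : ‖∫ z in (0 : ℝ)..y, (auxB h z : ℂ) * Complex.exp (-(Complex.I * K * z))‖
            ≤ ∫ z in (0 : ℝ)..y, auxB h z := by
          refine (intervalIntegral.norm_integral_le_integral_norm h0.le).trans_eq ?_
          congr 1
          funext z
          rw [norm_mul, Complex.norm_real, Real.norm_of_nonneg (hh.auxB_nonneg z),
            show -(Complex.I * K * z) = ((-(K * z) : ℝ) : ℂ) * Complex.I by push_cast; ring,
            Complex.norm_exp_ofReal_mul_I, mul_one]
        simp only [if_neg (not_le.2 h0)]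
        rw [sub_sub_cancel_left, norm_neg, norm_mul, norm_div, Complex.norm_real,
          Real.norm_of_nonneg hB.le, Real.norm_of_nonneg h0.le]
        simp only [norm_mul, Complex.norm_I, Complex.norm_real, Complex.norm_ofNat, mul_one,
          Real.norm_eq_abs]
        calc _ ≤ 2 * |K| / auxB h y * (ε / (2 * |K| + 1) * y * auxB h y) := by
              gcongr; exact hI.trans (hy h0)
          _ = ε * y * (2 * |K| / (2 * |K| + 1)) := by field_simp
          _ ≤ ε * y * 1 := by
              gcongr
              rw [div_le_one hK]; linarith
          _ = ε * y := mul_one _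
    convert! key.add (hasDerivAt_neg_exp K 0) using 1
    · funext y; simp
    · simp

theorem IsProfile.differentiable_modeR (hh : IsProfile h) (K : ℝ) :
    Differentiable ℝ (modeR h K) := fun y => by
  rcases le_or_gt y 0 with hy | hy
  · exact (hh.hasDerivAt_modeR_of_nonpos K hy).differentiableAt
  · exact (hh.hasDerivAt_modeR_of_pos K hy).differentiableAt

theorem norm_exp_neg_I_mul (K y : ℝ) : ‖Complex.exp (-(Complex.I * K * y))‖ = 1 := by
  rw [show -(Complex.I * K * y) = ((-(K * y) : ℝ) : ℂ) * Complex.I by push_cast; ring,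
    Complex.norm_exp_ofReal_mul_I]

theorem norm_add_mul_I_sq (a b : ℝ) : ‖(a : ℂ) + b * Complex.I‖ ^ 2 = a ^ 2 + b ^ 2 := by
  rw [Complex.sq_norm, Complex.normSq_add_mul_I]

variable {lam t r : ℝ}

theorem IsProfile.fluxIntegrand_of_nonpos (hh : IsProfile h) (hy : lam * (t - r) ≤ 0) (K : ℝ) :
    fluxIntegrand h lam t r K = 0 := by
  rw [fluxIntegrand, (hh.hasDerivAt_modeR_of_nonpos K hy).deriv]
  simp only [norm_mul, norm_exp_neg_I_mul, Complex.norm_I, Complex.norm_real, one_mul, mul_one,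
    Real.norm_eq_abs, sq_abs, sub_self, zero_div]

/-- Expanding `|R'|²` leaves `-4 K cot h · C / B + 4 K cot² h · (C² + S²) / B²`. Substituting
`mul_sq_add_sq_sub` and `B' = cot h · B` assembles the linear terms into the kernel. -/
theorem IsProfile.fluxIntegrand_of_pos (hh : IsProfile h) {y : ℝ} (hyd : y = lam * (t - r))
    (hy : 0 < y) (K : ℝ) :
    fluxIntegrand h lam t r K =
      4 * Real.cot (h y) / auxB h y ^ 2 * waveKernel (auxB h) K y
        - 4 * Real.cot (h y) ^ 2 / auxB h y ^ 2
          * ∫ u in (0 : ℝ)..y, waveKernel (auxB h) K u := by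
  have hB := (hh.auxB_pos hy).ne'
  have e := mul_sq_add_sq_sub (hh.contDiff_auxB 1) K y
  rw [fluxIntegrand, ← hyd, (hh.hasDerivAt_modeR_of_pos K hy).deriv, norm_mul, mul_pow,
    norm_add_mul_I_sq]
  simp only [norm_neg, norm_mul, norm_exp_neg_I_mul, Complex.norm_I, Complex.norm_real,
    one_mul, mul_one, Real.norm_eq_abs, sq_abs]
  rw [← neg_eq_iff_eq_neg.2 e, waveKernel, hh.deriv_auxB_of_pos hy]
  field_simp
  ring

theorem calGIntegrand_of_nonpos (hy : lam * (t - r) ≤ 0) (K : ℝ) :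
    calGIntegrand h lam t r K = 0 := by
  have h1 : modeR h K (lam * (t - r)) * Complex.exp (Complex.I * K * lam * (t + r))
      = -Complex.exp ((2 * K * lam * r : ℝ) * Complex.I) := by
    rw [modeR, if_pos hy, neg_mul, ← Complex.exp_add]
    congr 2
    push_cast; ring
  have h2 : (starRingEnd ℂ) (modeR h K (lam * (t - r)))
      * Complex.exp (-(Complex.I * K * lam * (t + r)))
      = (starRingEnd ℂ) (-Complex.exp ((2 * K * lam * r : ℝ) * Complex.I)) := by
    rw [← h1, map_mul, ← Complex.exp_conj]
    simp
  rw [calGIntegrand, h2, h1, modeR, if_pos hy, norm_neg, norm_exp_neg_I_mul, Complex.add_re,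
    Complex.conj_re, Complex.neg_re, Complex.exp_ofReal_mul_I_re]
  ring

/-- The interference of `R` with the phase `e^{iKx}` cancels `2 cos (2Kλr)` and leaves the sine
transform of `B` based at the advanced coordinate `x`. The term `|R|² - 1` is handled by
`mul_sq_add_sq_sub`. -/
theorem IsProfile.calGIntegrand_of_pos (hh : IsProfile h) {x y : ℝ} (hyd : y = lam * (t - r))
    (hxd : x = lam * (t + r)) (hy : 0 < y) {K : ℝ} (hK : 0 < K) :
    calGIntegrand h lam t r K =
      4 * (-(∫ u in (0 : ℝ)..y, waveKernel (auxB h) K u) / auxB h y ^ 2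
        + (∫ z in (0 : ℝ)..y, auxB h z * Real.sin (K * (x - z))) / auxB h y) := by
  have hB := (hh.auxB_pos hy).ne'
  have e := mul_sq_add_sq_sub (hh.contDiff_auxB 1) K y
  have e2 : ∫ z in (0 : ℝ)..y, auxB h z * Real.sin (K * (x - z))
      = Real.cos (K * (x - y)) * sinConv (auxB h) K y
        + Real.sin (K * (x - y)) * cosConv (auxB h) K y := by
    have hc := hh.continuous_auxB
    rw [sinConv, cosConv, ← intervalIntegral.integral_const_mul,
      ← intervalIntegral.integral_const_mul,
      ← intervalIntegral.integral_add (Continuous.intervalIntegrable (by fun_prop) _ _)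
      (Continuous.intervalIntegrable (by fun_prop) _ _)]
    congr 1
    funext z
    rw [show K * (x - z) = K * (x - y) + K * (y - z) by ring, Real.sin_add]
    ring
  set a := 1 - 2 * K * sinConv (auxB h) K y / auxB h y with ha
  set b := 2 * K * cosConv (auxB h) K y / auxB h y with hb
  have h1 : modeR h K y * Complex.exp (Complex.I * K * lam * (t + r))
      = -(Complex.exp ((K * (x - y) : ℝ) * Complex.I) * (a + b * Complex.I)) := by
    rw [hh.modeR_of_pos K hy, neg_mul, neg_mul, mul_right_comm, ← Complex.exp_add]
    congr 3
    rw [hxd]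
    push_cast; ring
  have h2 : (starRingEnd ℂ) (modeR h K y) * Complex.exp (-(Complex.I * K * lam * (t + r)))
      = (starRingEnd ℂ) (-(Complex.exp ((K * (x - y) : ℝ) * Complex.I) * (a + b * Complex.I))) := by
    rw [← h1, map_mul, ← Complex.exp_conj]
    simp
  have h3 : (-(Complex.exp ((K * (x - y) : ℝ) * Complex.I) * (a + b * Complex.I))).re
      = -(Real.cos (K * (x - y)) * a - Real.sin (K * (x - y)) * b) := by
    simp [Complex.exp_ofReal_mul_I_re, Complex.exp_ofReal_mul_I_im, -Complex.ofReal_mul]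
  rw [calGIntegrand, ← hyd, h2, h1, Complex.add_re, Complex.conj_re, h3, hh.modeR_of_pos K hy,
    norm_mul, norm_neg, norm_exp_neg_I_mul, one_mul, norm_add_mul_I_sq, e2, ← e,
    show 2 * K * lam * r = K * (x - y) by rw [hxd, hyd]; ring, ha, hb]
  field_simp
  ring

end

/-! ### Closed forms and regularity away from the light cone -/

section

variable {h : ℝ → ℝ} {lam t r : ℝ}

/-- Closed form of the frequency integral of `fluxIntegrand` at `y = λ (t - r)`. -/
def fluxTotal (h : ℝ → ℝ) (y : ℝ) : ℝ :=
  4 * Real.cot (h y) / auxB h y ^ 2 * waveTotal (auxB h) y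
    - 4 * Real.cot (h y) ^ 2 / auxB h y ^ 2 * ∫ u in (0 : ℝ)..y, waveTotal (auxB h) u

/-- The part of `𝒢_λ / 4` that depends on `y = λ (t - r)` only. -/
def selfPart (h : ℝ → ℝ) (y : ℝ) : ℝ :=
  -(∫ u in (0 : ℝ)..y, waveTotal (auxB h) u) / auxB h y ^ 2

/-- The remaining part of `𝒢_λ / 4`, with `y = λ (t - r)` and `L = λ t`. -/
def crossPart (h : ℝ → ℝ) (L y : ℝ) : ℝ :=
  (∫ z in (0 : ℝ)..y, auxB h z / (2 * L - y - z)) / auxB h y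

theorem IsProfile.integrableOn_fluxIntegrand (hh : IsProfile h) :
    IntegrableOn (fluxIntegrand h lam t r) (Ioi 0) := by
  rcases le_or_gt (lam * (t - r)) 0 with hy | hy
  · simp only [funext (hh.fluxIntegrand_of_nonpos hy)]
    exact integrableOn_zero
  · rw [funext (hh.fluxIntegrand_of_pos rfl hy)]
    exact ((integrableOn_waveKernel (hh.contDiff_auxB 3) (fun _ => auxB_of_nonpos) hy.le).const_mul
      _).sub ((integrableOn_integral_waveKernel (hh.contDiff_auxB 3) (fun _ => auxB_of_nonpos)
        hy.le).const_mul _)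

theorem IsProfile.fluxTerm_of_nonpos (hh : IsProfile h) (hy : lam * (t - r) ≤ 0) :
    fluxTerm h lam t r = 0 := by
  simp [fluxTerm, hh.fluxIntegrand_of_nonpos hy]

theorem IsProfile.fluxTerm_of_pos (hh : IsProfile h) (hy : 0 < lam * (t - r)) :
    fluxTerm h lam t r
      = lam ^ 2 / (16 * Real.pi ^ 2 * r ^ 2) * fluxTotal h (lam * (t - r)) := by
  have hB := hh.contDiff_auxB 3
  have h0 : ∀ y, y ≤ 0 → auxB h y = 0 := fun _ => auxB_of_nonpos
  rw [fluxTerm, funext (hh.fluxIntegrand_of_pos rfl hy), integral_sub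
    ((integrableOn_waveKernel hB h0 hy.le).const_mul _)
    ((integrableOn_integral_waveKernel hB h0 hy.le).const_mul _), integral_const_mul,
    integral_const_mul, setIntegral_waveKernel hB h0 hy.le,
    setIntegral_integral_waveKernel hB h0 hy.le, fluxTotal]

theorem tendsto_integral_integral_mul_sin {f : ℝ → ℝ} (hf : Continuous f) {x y : ℝ} (hy : 0 ≤ y)
    (hxy : y < x) :
    Tendsto (fun M => ∫ K in (0 : ℝ)..M, ∫ z in (0 : ℝ)..y, f z * Real.sin (K * (x - z))) atTop
      (𝓝 (∫ z in (0 : ℝ)..y, f z / (x - z))) := by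
  -- Truncating the denominator below at `x - y > 0` changes nothing on `[0, y]` and makes the
  -- quotient continuous on the whole line, as the Riemann–Lebesgue lemma here requires.
  set g : ℝ → ℝ := fun z => f z / max (x - z) (x - y) with hg
  have hgc : Continuous g := by
    refine hf.div (by fun_prop) fun z => ?_
    exact (lt_max_of_lt_right (sub_pos.2 hxy)).ne'
  have hgz : ∀ z ∈ uIcc 0 y, g z = f z / (x - z) := fun z hz => by
    rw [uIcc_of_le hy] at hz
    simp only [hg]
    rw [max_eq_left (by linarith [hz.2])]
  have hfz : ∀ z ∈ uIcc 0 y, f z = g z * (x - z) := fun z hz => by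
    rw [hgz z hz, div_mul_cancel₀]
    rw [uIcc_of_le hy] at hz
    exact (sub_pos.2 (hz.2.trans_lt hxy)).ne'
  rw [← intervalIntegral.integral_congr hgz]
  refine (tendsto_intervalIntegral_mul_one_sub_cos_atTop hgc x 0 y).congr fun M => ?_
  rw [integral_integral_swap_of_continuous (by simp only [Function.uncurry_def]; fun_prop)]
  refine intervalIntegral.integral_congr fun z hz => ?_
  simp only [hfz z hz, mul_assoc, intervalIntegral.integral_const_mul]
  rw [← integral_mul_sin, intervalIntegral.integral_const_mul]

theorem IsProfile.hasImproperIntegral_calGIntegrand (hh : IsProfile h) (hy : 0 < lam * (t - r))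
    (hr : 0 < lam * r) :
    HasImproperIntegral (calGIntegrand h lam t r)
      (4 * (selfPart h (lam * (t - r)) + crossPart h (lam * t) (lam * (t - r)))) := by
  set y := lam * (t - r) with hyd
  set x := lam * (t + r) with hxd
  have hxy : y < x := by rw [hyd, hxd]; linarith [hr]
  set g : ℝ → ℝ := fun K =>
    4 * (-(∫ u in (0 : ℝ)..y, waveKernel (auxB h) K u) / auxB h y ^ 2
        + (∫ z in (0 : ℝ)..y, auxB h z * Real.sin (K * (x - z))) / auxB h y) with hg
  have hc := hh.continuous_auxB
  have c1 : Continuous fun K => ∫ u in (0 : ℝ)..y, waveKernel (auxB h) K u :=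
    intervalIntegral.continuous_parametric_intervalIntegral_of_continuous'
      (continuous_waveKernel (hh.contDiff_auxB 1)) 0 y
  have c2 : Continuous fun K => ∫ z in (0 : ℝ)..y, auxB h z * Real.sin (K * (x - z)) :=
    intervalIntegral.continuous_parametric_intervalIntegral_of_continuous'
      (by simp only [Function.uncurry_def]; fun_prop) 0 y
  have hgc : Continuous g := by simp only [hg]; fun_prop
  -- The singular-looking factor `1 / K` has cancelled: on `K > 0` the integrand agrees with a
  -- function continuous at `K = 0` too, which gives local integrability.
  have heq : ∀ M, EqOn (calGIntegrand h lam t r) g (Ioc 0 M) := fun M K hK =>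
    hh.calGIntegrand_of_pos hyd hxd hy hK.1
  refine ⟨fun M _ => hgc.integrableOn_Ioc.congr_fun (heq M).symm measurableSet_Ioc, ?_⟩
  have h1 := tendsto_integral_integral_waveKernel (hh.contDiff_auxB 2) (auxB_of_nonpos le_rfl) hy.le
  have h2 := tendsto_integral_integral_mul_sin hc hy.le hxy
  have h3 := (((h1.neg.div_const (auxB h y ^ 2)).add (h2.div_const (auxB h y))).const_mul 4)
  have hx' : ∀ z, 2 * (lam * t) - y - z = x - z := fun z => by rw [hyd, hxd]; ring
  simp only [selfPart, crossPart, hx']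
  refine h3.congr' ?_
  filter_upwards [eventually_ge_atTop 0] with M hM
  rw [setIntegral_congr_fun measurableSet_Ioc (heq M), ← intervalIntegral.integral_of_le hM]
  simp only [hg]
  rw [intervalIntegral.integral_const_mul, intervalIntegral.integral_add
    (Continuous.intervalIntegrable (by fun_prop) _ _)
    (Continuous.intervalIntegrable (by fun_prop) _ _), intervalIntegral.integral_div,
    intervalIntegral.integral_div, intervalIntegral.integral_neg]

theorem IsProfile.calG_of_pos (hh : IsProfile h) (hy : 0 < lam * (t - r)) (hr : 0 < lam * r) :
    calG h lam t r
      = 4 * (selfPart h (lam * (t - r)) + crossPart h (lam * t) (lam * (t - r))) :=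
  (hh.hasImproperIntegral_calGIntegrand hy hr).2.limUnder_eq

theorem hasImproperIntegral_calGIntegrand_of_nonpos (hy : lam * (t - r) ≤ 0) :
    HasImproperIntegral (calGIntegrand h lam t r) 0 := by
  rw [funext (calGIntegrand_of_nonpos hy)]
  exact ⟨fun M _ => integrableOn_zero, by simp⟩

theorem calG_of_nonpos (hy : lam * (t - r) ≤ 0) : calG h lam t r = 0 :=
  (hasImproperIntegral_calGIntegrand_of_nonpos hy).2.limUnder_eq

theorem IsProfile.hasImproperIntegral_calG (hh : IsProfile h) (hlam : 0 < lam) (hr : 0 < r) :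
    HasImproperIntegral (calGIntegrand h lam t r) (calG h lam t r) := by
  rcases le_or_gt (lam * (t - r)) 0 with hy | hy
  · rw [calG_of_nonpos hy]; exact hasImproperIntegral_calGIntegrand_of_nonpos hy
  · rw [hh.calG_of_pos hy (mul_pos hlam hr)]
    exact hh.hasImproperIntegral_calGIntegrand hy (mul_pos hlam hr)

/-- Differentiation under the integral sign, on a compact interval, with continuous derivative. -/
theorem hasDerivAt_and_continuousAt_integral {f f' : ℝ → ℝ → ℝ} {U : Set ℝ} (hU : IsOpen U)
    {a b : ℝ} (hf : ContinuousOn f.uncurry (U ×ˢ uIcc a b))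
    (hf' : ContinuousOn f'.uncurry (U ×ˢ uIcc a b))
    (hd : ∀ x ∈ U, ∀ s ∈ uIcc a b, HasDerivAt (fun x => f x s) (f' x s) x) {x : ℝ} (hx : x ∈ U) :
    HasDerivAt (fun x => ∫ s in a..b, f x s) (∫ s in a..b, f' x s) x ∧
      ContinuousAt (fun x => ∫ s in a..b, f' x s) x := by
  obtain ⟨δ, hδ, hδU⟩ := Metric.nhds_basis_closedBall.mem_iff.1 (hU.mem_nhds hx)
  have hcomp : IsCompact (Metric.closedBall x δ ×ˢ uIcc a b) :=
    (isCompact_closedBall x δ).prod isCompact_uIcc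
  obtain ⟨C, hC⟩ := hcomp.exists_bound_of_continuousOn (hf'.mono (prod_mono_left hδU))
  have slice : ∀ {g : ℝ → ℝ → ℝ}, ContinuousOn g.uncurry (U ×ˢ uIcc a b) → ∀ x ∈ U,
      ContinuousOn (g x) (uIcc a b) := fun hg x hx =>
    hg.comp (continuousOn_const.prodMk continuousOn_id) fun s hs => ⟨hx, hs⟩
  have meas : ∀ {g : ℝ → ℝ → ℝ}, ContinuousOn g.uncurry (U ×ˢ uIcc a b) → ∀ x ∈ U,
      AEStronglyMeasurable (g x) (volume.restrict (uIoc a b)) := fun hg x hx =>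
    ((slice hg x hx).mono uIoc_subset_uIcc).aestronglyMeasurable measurableSet_uIoc
  have hball := Metric.closedBall_mem_nhds x hδ
  constructor
  · refine (intervalIntegral.hasDerivAt_integral_of_dominated_loc_of_deriv_le (bound := fun _ => C)
      hball ?_ (slice hf x hx).intervalIntegrable (meas hf' x hx) ?_ (by simp) ?_).2
    · filter_upwards [hball] with u hu using meas hf u (hδU hu)
    · exact ae_of_all _ fun s hs u hu => hC (u, s) ⟨hu, uIoc_subset_uIcc hs⟩
    · exact ae_of_all _ fun s hs u hu => hd u (hδU hu) s (uIoc_subset_uIcc hs)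
  · refine intervalIntegral.continuousAt_of_dominated_interval (bound := fun _ => C) ?_ ?_
      (by simp) ?_
    · filter_upwards [hball] with u hu using meas hf' u (hδU hu)
    · filter_upwards [hball] with u hu
      exact ae_of_all _ fun s hs => hC (u, s) ⟨hu, uIoc_subset_uIcc hs⟩
    · refine ae_of_all _ fun s hs => ?_
      have : ContinuousOn (fun u => f' u s) U :=
        hf'.comp (continuousOn_id.prodMk continuousOn_const)
          fun u hu => ⟨hu, uIoc_subset_uIcc hs⟩
      exact this.continuousAt (hU.mem_nhds hx)

/-- Change of variables `z = y - s`, and extension by zero to a fixed interval. -/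
theorem integral_eq_integral_sub {f : ℝ → ℝ} {g : ℝ → ℝ} {L y : ℝ} (hyL : y ≤ L)
    (hf : Continuous f) (h0 : ∀ z, z ≤ 0 → f z = 0) (hg : ContinuousOn g (Iic L)) (hy : 0 ≤ y) :
    ∫ z in (0 : ℝ)..y, f z * g z = ∫ s in (0 : ℝ)..L, f (y - s) * g (y - s) := by
  have h1 := intervalIntegral.integral_comp_sub_left (fun z => f z * g z) (a := 0) (b := y) y
  have hcont : ContinuousOn (fun s => f (y - s) * g (y - s)) (Ici 0) :=
    (hf.comp (continuous_const.sub continuous_id)).continuousOn.mul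
      (hg.comp (by fun_prop) fun s hs => by simp only [mem_Ici] at hs; simp only [mem_Iic]; linarith)
  have hi : ∀ a b, 0 ≤ a → 0 ≤ b →
      IntervalIntegrable (fun s => f (y - s) * g (y - s)) volume a b := fun a b ha hb =>
    (hcont.mono fun s hs => le_trans (le_min ha hb) hs.1).intervalIntegrable
  rw [← intervalIntegral.integral_add_adjacent_intervals (hi 0 y le_rfl hy)
    (hi y L hy (hy.trans hyL)), h1]
  have h2 : ∫ s in y..L, f (y - s) * g (y - s) = ∫ s in y..L, (0 : ℝ) :=
    intervalIntegral.integral_congr fun s hs => by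
      rw [uIcc_of_le hyL] at hs
      simp [h0 (y - s) (by linarith [hs.1])]
  rw [h2]; simp

/-- Derivative in `y` of the integral in `crossPart h L y`. -/
def crossDeriv (h : ℝ → ℝ) (L y : ℝ) : ℝ :=
  ∫ z in (0 : ℝ)..y, (deriv (auxB h) z / (2 * L - y - z)
    + 2 * (auxB h z / (2 * L - y - z) ^ 2))

/-- The substitution `z = y - s` moves `y` from the limits into the integrand; since `B` vanishes on
`s ≥ y`, the domain can be fixed as `[0, L]`. The denominator becomes `2L - 2y + s`, which is
positive there for `y < L`, so one may differentiate under the integral. -/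
theorem IsProfile.hasDerivAt_cross (hh : IsProfile h) {L y : ℝ} (hy : 0 < y) (hyL : y < L) :
    HasDerivAt (fun y => ∫ z in (0 : ℝ)..y, auxB h z / (2 * L - y - z)) (crossDeriv h L y) y ∧
      ContinuousAt (crossDeriv h L) y := by
  have hc := hh.continuous_auxB
  have hB := hh.contDiff_auxB 1
  have hc' := hB.continuous_deriv le_rfl
  have h0 : ∀ z, z ≤ 0 → auxB h z = 0 := fun _ => auxB_of_nonpos
  have h0' : ∀ z, z ≤ 0 → deriv (auxB h) z = 0 := fun z =>
    deriv_eq_zero_of_eq_zero_nonpos (hB.differentiable one_ne_zero) h0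
  have hne : ∀ p : ℝ × ℝ, p ∈ Iio L ×ˢ uIcc 0 L → 2 * L - 2 * p.1 + p.2 ≠ 0 := fun p hp => by
    have h1 : p.1 < L := hp.1
    have h2 := hp.2
    rw [uIcc_of_le (hy.trans hyL).le] at h2
    linarith [h2.1]
  have hg : ∀ n : ℕ, ∀ u < L, ContinuousOn (fun z => ((2 * L - u - z) ^ n)⁻¹) (Iic L) :=
    fun n u hu => ContinuousOn.inv₀ (by fun_prop) fun z hz =>
      pow_ne_zero n (by simp only [mem_Iic] at hz; linarith)
  obtain ⟨d1, d2⟩ := hasDerivAt_and_continuousAt_integral (U := Iio L) isOpen_Iio (a := 0) (b := L)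
    (f := fun y s => auxB h (y - s) / (2 * L - 2 * y + s))
    (f' := fun y s => deriv (auxB h) (y - s) / (2 * L - 2 * y + s)
      + 2 * (auxB h (y - s) / (2 * L - 2 * y + s) ^ 2))
    (ContinuousOn.div (by fun_prop) (by fun_prop) hne)
    ((ContinuousOn.div (by fun_prop) (by fun_prop) hne).add (continuousOn_const.mul
      (ContinuousOn.div (by fun_prop) (by fun_prop) fun p hp => pow_ne_zero 2 (hne p hp))))
    (fun u hu s hs => by
      have e1 : HasDerivAt (fun u => auxB h (u - s)) (deriv (auxB h) (u - s)) u :=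
        ((hB.differentiable one_ne_zero (u - s)).hasDerivAt).comp_sub_const u s
      have e2 : HasDerivAt (fun u => 2 * L - 2 * u + s) (-2) u := by
        simpa using (((hasDerivAt_id u).const_mul 2).const_sub (2 * L)).add_const s
      have := hne (u, s) ⟨hu, hs⟩
      convert! e1.div e2 this using 1
      simp only at this
      field_simp
      ring) (show y ∈ Iio L from hyL)
  have hnhds : Ioo 0 L ∈ 𝓝 y := Ioo_mem_nhds hy hyL
  have q1 : (fun y => ∫ z in (0 : ℝ)..y, auxB h z / (2 * L - y - z)) =ᶠ[𝓝 y]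
      fun y => ∫ s in (0 : ℝ)..L, auxB h (y - s) / (2 * L - 2 * y + s) := by
    filter_upwards [hnhds] with u hu
    have := integral_eq_integral_sub hu.2.le hc h0 (hg 1 u hu.2) hu.1.le
    simp only [pow_one, ← div_eq_mul_inv] at this
    rw [this]
    congr 1; funext s; congr 1; ring
  have q2 : crossDeriv h L =ᶠ[𝓝 y] fun y => ∫ s in (0 : ℝ)..L,
      (deriv (auxB h) (y - s) / (2 * L - 2 * y + s)
        + 2 * (auxB h (y - s) / (2 * L - 2 * y + s) ^ 2)) := by
    filter_upwards [hnhds] with u hu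
    have hint : ∀ n : ℕ, ∀ f : ℝ → ℝ, Continuous f →
        IntervalIntegrable (fun z => f z * ((2 * L - u - z) ^ n)⁻¹) volume 0 u := fun n f hf =>
      (hf.continuousOn.mul ((hg n u hu.2).mono fun z hz => by
        rw [uIcc_of_le hu.1.le] at hz; exact hz.2.trans hu.2.le)).intervalIntegrable
    have hint2 : ∀ n : ℕ, ∀ f : ℝ → ℝ, Continuous f →
        IntervalIntegrable (fun s => f (u - s) * ((2 * L - u - (u - s)) ^ n)⁻¹) volume 0 L :=
      fun n f hf => ((hf.comp (continuous_const.sub continuous_id)).continuousOn.mul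
        ((hg n u hu.2).comp (by fun_prop) fun s hs => by
          rw [uIcc_of_le (hy.trans hyL).le] at hs
          simp only [mem_Iic]; linarith [hs.1, hu.2])).intervalIntegrable
    have t1 := integral_eq_integral_sub hu.2.le hc' h0' (hg 1 u hu.2) hu.1.le
    have t2 := integral_eq_integral_sub hu.2.le hc h0 (hg 2 u hu.2) hu.1.le
    have e1 := hint 1 _ hc'
    have e2 := hint2 1 _ hc'
    simp only [pow_one] at t1 e1 e2
    unfold crossDeriv
    simp only [div_eq_mul_inv]
    rw [intervalIntegral.integral_add e1 ((hint 2 _ hc).const_mul 2),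
      intervalIntegral.integral_const_mul, t1, t2, ← intervalIntegral.integral_const_mul,
      ← intervalIntegral.integral_add e2 ((hint2 2 _ hc).const_mul 2)]
    congr 1; funext s
    rw [show 2 * L - u - (u - s) = 2 * L - 2 * u + s by ring]
  exact ⟨(d1.congr_of_eventuallyEq q1).congr_deriv q2.eq_of_nhds.symm, d2.congr q2.symm⟩

/-- Derivative of `selfPart h`. -/
def selfPartDeriv (h : ℝ → ℝ) (y : ℝ) : ℝ :=
  (2 * Real.cot (h y) * (∫ u in (0 : ℝ)..y, waveTotal (auxB h) u) - waveTotal (auxB h) y)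
    / auxB h y ^ 2

/-- Derivative of `crossPart h L`. -/
def crossPartDeriv (h : ℝ → ℝ) (L y : ℝ) : ℝ :=
  (crossDeriv h L y - Real.cot (h y) * ∫ z in (0 : ℝ)..y, auxB h z / (2 * L - y - z)) / auxB h y

theorem IsProfile.hasDerivAt_selfPart (hh : IsProfile h) {y : ℝ} (hy : 0 < y) :
    HasDerivAt (selfPart h) (selfPartDeriv h y) y := by
  have hB := (hh.auxB_pos hy).ne'
  convert! ((hasDerivAt_integral_of_continuous
    (continuous_waveTotal (hh.contDiff_auxB 2)) y).neg).div
    ((hh.hasDerivAt_auxB_of_pos hy).pow 2) (pow_ne_zero 2 hB) using 1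
  simp only [selfPartDeriv, Pi.pow_apply, Pi.neg_apply]
  field_simp
  ring

theorem IsProfile.continuousAt_cot (hh : IsProfile h) {y : ℝ} (hy : 0 < y) :
    ContinuousAt (fun z => Real.cot (h z)) y :=
  hh.continuousOn_cot.continuousAt (Ioi_mem_nhds hy)

theorem IsProfile.continuous_integral_waveTotal (hh : IsProfile h) :
    Continuous fun y => ∫ u in (0 : ℝ)..y, waveTotal (auxB h) u :=
  continuous_iff_continuousAt.2 fun y =>
    (hasDerivAt_integral_of_continuous (continuous_waveTotal (hh.contDiff_auxB 2)) y).continuousAt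

theorem IsProfile.continuousAt_selfPartDeriv (hh : IsProfile h) {y : ℝ} (hy : 0 < y) :
    ContinuousAt (selfPartDeriv h) y :=
  ((((hh.continuousAt_cot hy).const_mul 2).mul
    hh.continuous_integral_waveTotal.continuousAt).sub
    (continuous_waveTotal (hh.contDiff_auxB 2)).continuousAt).div
    (hh.continuous_auxB.continuousAt.pow 2) (pow_ne_zero 2 (hh.auxB_pos hy).ne')

theorem IsProfile.continuousAt_fluxTotal (hh : IsProfile h) {y : ℝ} (hy : 0 < y) :
    ContinuousAt (fluxTotal h) y := by
  have h1 := hh.continuousAt_cot hy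
  have h2 := hh.continuous_auxB.continuousAt (x := y)
  have h3 := hh.continuous_integral_waveTotal.continuousAt (x := y)
  have h4 := (continuous_waveTotal (hh.contDiff_auxB 2)).continuousAt (x := y)
  have h5 := pow_ne_zero 2 (hh.auxB_pos hy).ne'
  exact (((h1.const_mul 4).div (h2.pow 2) h5).mul h4).sub
    ((((h1.pow 2).const_mul 4).div (h2.pow 2) h5).mul h3)

theorem IsProfile.hasDerivAt_crossPart (hh : IsProfile h) {L y : ℝ} (hy : 0 < y) (hyL : y < L) :
    HasDerivAt (crossPart h L) (crossPartDeriv h L y) y := by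
  have hB := (hh.auxB_pos hy).ne'
  convert! (hh.hasDerivAt_cross hy hyL).1.div (hh.hasDerivAt_auxB_of_pos hy) hB using 1
  simp only [crossPartDeriv]
  field_simp

theorem IsProfile.continuousAt_crossPartDeriv (hh : IsProfile h) {L y : ℝ} (hy : 0 < y)
    (hyL : y < L) : ContinuousAt (crossPartDeriv h L) y :=
  ((hh.hasDerivAt_cross hy hyL).2.sub ((hh.continuousAt_cot hy).mul
    (hh.hasDerivAt_cross hy hyL).1.continuousAt)).div hh.continuous_auxB.continuousAt
    (hh.auxB_pos hy).ne'

theorem IsProfile.hasDerivAt_calG (hh : IsProfile h) (hlam : 0 < lam) (hr : 0 < r) (hrt : r < t) :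
    HasDerivAt (calG h lam t) (-(4 * lam) * (selfPartDeriv h (lam * (t - r))
      + crossPartDeriv h (lam * t) (lam * (t - r)))) r := by
  have hy : 0 < lam * (t - r) := mul_pos hlam (sub_pos.2 hrt)
  have hyL : lam * (t - r) < lam * t := mul_lt_mul_of_pos_left (by linarith) hlam
  have hl : HasDerivAt (fun r => lam * (t - r)) (-lam) r := by
    simpa using ((hasDerivAt_id r).const_sub t).const_mul lam
  have := (((hh.hasDerivAt_selfPart hy).add (hh.hasDerivAt_crossPart hy hyL)).comp r
    hl).const_mul 4
  refine (this.congr_of_eventuallyEq ?_).congr_deriv (by ring)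
  filter_upwards [Ioo_mem_nhds hr hrt] with u hu
  rw [hh.calG_of_pos (mul_pos hlam (sub_pos.2 hu.2)) (mul_pos hlam hu.1)]
  rfl

theorem IsProfile.continuousOn_deriv_calG (hh : IsProfile h) (hlam : 0 < lam) :
    ContinuousOn (deriv (calG h lam t)) (Ioo 0 t) := by
  have : ContinuousOn (fun r => -(4 * lam) * (selfPartDeriv h (lam * (t - r))
      + crossPartDeriv h (lam * t) (lam * (t - r)))) (Ioo 0 t) := fun r hr => by
    have hy : 0 < lam * (t - r) := mul_pos hlam (sub_pos.2 hr.2)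
    have hyL : lam * (t - r) < lam * t := mul_lt_mul_of_pos_left (by linarith [hr.1]) hlam
    have hl : ContinuousAt (fun r => lam * (t - r)) r := by fun_prop
    exact (((ContinuousAt.comp (f := fun r => lam * (t - r)) (hh.continuousAt_selfPartDeriv hy)
      hl).add (ContinuousAt.comp (f := fun r => lam * (t - r))
        (hh.continuousAt_crossPartDeriv hy hyL) hl)).const_mul _).continuousWithinAt
  exact this.congr fun r hr => (hh.hasDerivAt_calG hlam hr.1 hr.2).deriv

theorem IsProfile.continuousOn_fluxTerm (hh : IsProfile h) (hlam : 0 < lam) :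
    ContinuousOn (fluxTerm h lam t) (Ioo 0 t) := by
  have : ContinuousOn (fun r => lam ^ 2 / (16 * Real.pi ^ 2 * r ^ 2)
      * fluxTotal h (lam * (t - r))) (Ioo 0 t) := fun r hr => by
    have hr0 := hr.1.ne'
    have hpi := Real.pi_ne_zero
    have hl : ContinuousAt (fun r => lam * (t - r)) r := by fun_prop
    refine ((ContinuousAt.div (by fun_prop) (by fun_prop) (by positivity)).mul
      (ContinuousAt.comp (f := fun r => lam * (t - r))
        (hh.continuousAt_fluxTotal (mul_pos hlam (sub_pos.2 hr.2))) hl)).continuousWithinAt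
  exact this.congr fun r hr => hh.fluxTerm_of_pos (mul_pos hlam (sub_pos.2 hr.2))

end

/-! ### Estimates near the light cone in terms of `T = tan h` -/

section

variable {h : ℝ → ℝ} {y p q ε : ℝ}

theorem IsProfile.hasDerivAt_tan (hh : IsProfile h) (hy : y < 1) :
    HasDerivAt (fun y => Real.tan (h y)) (deriv (fun y => Real.tan (h y)) y) y :=
  ((hh.contDiffOn_tan.contDiffAt (Iio_mem_nhds hy)).differentiableAt (by simp)).hasDerivAt

theorem IsProfile.sub_mul_wronskQuot_auxB (hh : IsProfile h) {u z : ℝ} (hu : u < 1) (hz : z < 1) :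
    (u - z) * wronskQuot (auxB h) u z = deriv (auxB h) u * deriv (auxB h) z
      * (Real.tan (h z) - Real.tan (h u)) := by
  rw [sub_mul_wronskQuot (hh.contDiff_auxB 2)]
  linear_combination deriv (auxB h) u * hh.auxB_eq_tan_mul hz
    - deriv (auxB h) z * hh.auxB_eq_tan_mul hu

theorem IsProfile.integral_deriv_mul_auxB (hh : IsProfile h) (y : ℝ) :
    ∫ u in (0 : ℝ)..y, deriv (auxB h) u * auxB h u = auxB h y ^ 2 / 2 := by
  have h1 := hh.contDiff_auxB 1
  have hc := h1.continuous
  have hc' := h1.continuous_deriv le_rfl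
  rw [intervalIntegral.integral_eq_sub_of_hasDerivAt (f := fun u => auxB h u ^ 2 / 2)
    (fun z _ => by
      convert! ((h1.differentiable one_ne_zero z).hasDerivAt.pow 2).div_const 2 using 1
      simp; ring) (Continuous.intervalIntegrable (by fun_prop) _ _)]
  simp [auxB_of_nonpos le_rfl]

theorem IsProfile.monotone_auxB (hh : IsProfile h) : Monotone (auxB h) :=
  monotone_of_deriv_nonneg ((hh.contDiff_auxB 1).differentiable one_ne_zero) hh.deriv_auxB_nonneg

/-- A Lipschitz bound `ε` for `T` bounds the divided Wronskian by `ε B'(u) B'(z)`, hence `waveTotal`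
by `ε B' B`, whose integral is `ε B² / 2`. -/
theorem IsProfile.abs_selfPart_le (hh : IsProfile h) (hy : 0 < y) (hy1 : y < 1)
    (hb : ∀ z ∈ Icc 0 y, |deriv (fun y => Real.tan (h y)) z| ≤ ε) : |selfPart h y| ≤ ε / 2 := by
  have hc := hh.continuous_auxB
  have hc' := (hh.contDiff_auxB 1).continuous_deriv le_rfl
  have hk := continuous_wronskQuot (hh.contDiff_auxB 2)
  have hQ := continuous_waveTotal (hh.contDiff_auxB 2)
  have hm : ∀ u ∈ Icc 0 y, ∀ z ∈ Icc 0 y, |Real.tan (h z) - Real.tan (h u)| ≤ ε * |z - u| :=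
    fun u hu z hz => by
      simpa using (convex_Icc 0 y).norm_image_sub_le_of_norm_deriv_le (𝕜 := ℝ) (C := ε)
        (f := fun y => Real.tan (h y))
        (fun y hy => (hh.hasDerivAt_tan (hy.2.trans_lt hy1)).differentiableAt) hb hu hz
  have hQb : ∀ u ∈ Icc 0 y, |waveTotal (auxB h) u| ≤ ε * (deriv (auxB h) u * auxB h u) := by
    intro u hu
    have hku : Continuous (wronskQuot (auxB h) u) :=
      hk.comp (continuous_const.prodMk continuous_id)
    rw [← hh.integral_deriv_auxB u, ← intervalIntegral.integral_const_mul,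
      ← intervalIntegral.integral_const_mul]
    refine (intervalIntegral.abs_integral_le_integral_abs hu.1).trans ?_
    -- The comparison is made for `z < u` only, since the Wronskian identity has to be divided by `u
    -- - z`.
    refine intervalIntegral.integral_mono_on_of_le_Ioo hu.1
      (Continuous.intervalIntegrable (by fun_prop) _ _)
      (Continuous.intervalIntegrable (by fun_prop) _ _) fun z hz => ?_
    have h1 := hm u hu z ⟨hz.1.le, hz.2.le.trans hu.2⟩
    have h2 := hh.sub_mul_wronskQuot_auxB (hu.2.trans_lt hy1) ((hz.2.trans_le hu.2).trans hy1)
    have h3 := hh.deriv_auxB_nonneg u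
    have h4 := hh.deriv_auxB_nonneg z
    have h5 := congrArg abs h2
    rw [abs_mul, abs_mul, abs_mul, abs_of_nonneg h3, abs_of_nonneg h4,
      abs_of_pos (sub_pos.2 hz.2)] at h5
    rw [abs_sub_comm z u, abs_of_pos (sub_pos.2 hz.2)] at h1
    refine le_of_mul_le_mul_left ?_ (sub_pos.2 hz.2)
    rw [h5]
    calc _ ≤ deriv (auxB h) u * deriv (auxB h) z * (ε * (u - z)) := by gcongr
      _ = _ := by ring
  have hB := hh.auxB_pos hy
  rw [selfPart, abs_div, abs_neg, abs_of_pos (by positivity : 0 < auxB h y ^ 2),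
    div_le_iff₀ (by positivity)]
  refine (intervalIntegral.abs_integral_le_integral_abs hy.le).trans ?_
  calc _ ≤ ∫ u in (0 : ℝ)..y, ε * (deriv (auxB h) u * auxB h u) :=
        intervalIntegral.integral_mono_on hy.le (Continuous.intervalIntegrable (by fun_prop) _ _)
          (Continuous.intervalIntegrable (by fun_prop) _ _) hQb
    _ = _ := by
        rw [intervalIntegral.integral_const_mul, hh.integral_deriv_mul_auxB]; ring

theorem IsProfile.abs_crossPart_le (hh : IsProfile h) {L : ℝ} (hy : 0 < y) (hyL : 2 * y ≤ L) :
    |crossPart h L y| ≤ (∫ z in (0 : ℝ)..y, auxB h z) / (L * auxB h y) := by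
  have hB := hh.auxB_pos hy
  have hc := hh.continuous_auxB
  rw [crossPart, abs_div, abs_of_pos hB, ← div_div]
  refine div_le_div_of_nonneg_right ?_ hB.le
  refine (intervalIntegral.abs_integral_le_integral_abs hy.le).trans ?_
  rw [← intervalIntegral.integral_div]
  have hne : ∀ z ∈ uIcc 0 y, L ≤ 2 * L - y - z := fun z hz => by
    rw [uIcc_of_le hy.le] at hz; linarith [hz.2]
  refine intervalIntegral.integral_mono_on hy.le
    (ContinuousOn.intervalIntegrable ?_) (Continuous.intervalIntegrable (by fun_prop) _ _)
    fun z hz => ?_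
  · exact (ContinuousOn.div (by fun_prop) (by fun_prop)
      fun z hz => by linarith [hne z hz]).abs
  · have := hne z (by rwa [uIcc_of_le hy.le])
    rw [abs_div, abs_of_nonneg (hh.auxB_nonneg z), abs_of_pos (by linarith)]
    exact div_le_div_of_nonneg_left (hh.auxB_nonneg z) (by linarith) this

/-- Smallness of `T''` near `0` gives `|T'| ≤ ε y` on `[0, y]`, which controls `selfPart`;
`crossPart` is at most `∫ B / (L B)`. No sign of `T'''` is needed for this. -/
theorem IsProfile.eventually_abs_selfPart_add_crossPart_le (hh : IsProfile h) {L : ℝ} (hL : 0 < L)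
    (hε : 0 < ε) : ∀ᶠ y in 𝓝[>] (0 : ℝ), |selfPart h y + crossPart h L y| ≤ ε * y := by
  obtain ⟨δ, hδ, hδ1, hb⟩ := hh.exists_abs_iteratedDeriv_tan_le 2 hε
  filter_upwards [Ioo_mem_nhdsGT hδ, Ioo_mem_nhdsGT (half_pos hL),
    hh.integral_auxB_le (ε := ε * L / 2) (by positivity)] with y hy hyL hI
  have h1 : |selfPart h y| ≤ ε * y / 2 := by
    refine hh.abs_selfPart_le hy.1 (hy.2.trans hδ1) fun z hz => ?_
    have hT0 := hh.iteratedDeriv_tan_zero 1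
    rw [iteratedDeriv_one] at hT0
    have hd := hh.contDiffOn_tan.deriv_of_isOpen (m := ∞) isOpen_Iio (by simp)
    have := (convex_Icc 0 y).norm_image_sub_le_of_norm_deriv_le (𝕜 := ℝ) (C := ε)
        (f := deriv fun y => Real.tan (h y)) (x := 0) (y := z)
        (fun z hz => (hd.contDiffAt (Iio_mem_nhds ((hz.2.trans_lt hy.2).trans
          hδ1))).differentiableAt (by simp)) (fun z hz => by
          have := hb z (abs_lt.2 ⟨by linarith [hz.1], hz.2.trans_lt hy.2⟩)
          rwa [iteratedDeriv_succ, iteratedDeriv_one] at this) ⟨le_rfl, hy.1.le⟩ hz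
    rw [hT0, sub_zero, sub_zero, Real.norm_eq_abs, Real.norm_eq_abs, abs_of_nonneg hz.1] at this
    exact this.trans (mul_le_mul_of_nonneg_left hz.2 hε.le)
  have h2 : |crossPart h L y| ≤ ε * y / 2 := by
    refine (hh.abs_crossPart_le hy.1 (by linarith [hyL.2])).trans ?_
    have hB := hh.auxB_pos hy.1
    rw [div_le_iff₀ (by positivity)]
    linarith
  linarith [abs_add_le (selfPart h y) (crossPart h L y)]

/-- To the right of `t` the function is identically zero, and to the left it is `o(t - r)` by the
preceding estimate. -/
theorem IsProfile.hasDerivAt_calG_self (hh : IsProfile h) {lam t : ℝ} (hlam : 0 < lam)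
    (ht : 0 < t) : HasDerivAt (calG h lam t) 0 t := by
  rw [hasDerivAt_iff_isLittleO]
  simp only [calG_of_nonpos (h := h) (show lam * (t - t) ≤ 0 by simp), sub_zero, smul_zero]
  refine Asymptotics.isLittleO_iff.2 fun ε hε => ?_
  have h1 := eventually_nhdsWithin_iff.1
    (hh.eventually_abs_selfPart_add_crossPart_le (mul_pos hlam ht) (ε := ε / (4 * lam))
      (by positivity))
  have hl : Tendsto (fun r => lam * (t - r)) (𝓝 t) (𝓝 0) := by
    have : Continuous fun r => lam * (t - r) := by fun_prop
    simpa using this.tendsto t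
  filter_upwards [hl.eventually h1, Ioi_mem_nhds ht] with r hr hr0
  rcases le_or_gt (lam * (t - r)) 0 with hy | hy
  · rw [calG_of_nonpos hy, norm_zero]; positivity
  · rw [hh.calG_of_pos hy (mul_pos hlam hr0), norm_mul, Real.norm_eq_abs, Real.norm_eq_abs,
      Real.norm_eq_abs, abs_sub_comm, abs_of_pos (pos_of_mul_pos_right hy hlam.le)]
    have := hr hy
    calc _ ≤ |(4 : ℝ)| * (ε / (4 * lam) * (lam * (t - r))) := by gcongr
      _ = _ := by rw [abs_of_pos (by norm_num)]; field_simp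

/-- One-sided bounds on `(tan h)'` on `[0, y]`, as they follow from `(tan h)''' ≥ 0`. -/
structure TanBounds (h : ℝ → ℝ) (y p q : ℝ) : Prop where
  pos : 0 < y
  lt_one : y < 1
  nonneg : 0 ≤ q
  deriv_nonneg : ∀ z ∈ Icc 0 y, 0 ≤ deriv (fun y => Real.tan (h y)) z
  deriv_le : ∀ z ∈ Icc 0 y, deriv (fun y => Real.tan (h y)) z ≤ p
  le_deriv : ∀ z ∈ Icc 0 y, p - (y - z) * q ≤ deriv (fun y => Real.tan (h y)) z

theorem TanBounds.tan_sub_le (hb : TanBounds h y p q) (hh : IsProfile h) {u z : ℝ} (hz : 0 ≤ z)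
    (hzu : z ≤ u) (hu : u ≤ y) : Real.tan (h u) - Real.tan (h z) ≤ p * (u - z) :=
  Convex.image_sub_le_mul_sub_of_deriv_le (convex_Icc 0 y)
    (fun _ hw => (hh.hasDerivAt_tan (hw.2.trans_lt hb.lt_one)).continuousAt.continuousWithinAt)
    (fun _ hw => (hh.hasDerivAt_tan ((interior_subset hw).2.trans_lt
      hb.lt_one)).differentiableAt.differentiableWithinAt)
    (fun w hw => hb.deriv_le w (interior_subset hw)) z ⟨hz, hzu.trans hu⟩ u ⟨hz.trans hzu, hu⟩ hzu

theorem TanBounds.le_tan_sub (hb : TanBounds h y p q) (hh : IsProfile h) {u z : ℝ} (hz : 0 ≤ z)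
    (hzu : z ≤ u) (hu : u ≤ y) :
    (p - (y - z) * q) * (u - z) ≤ Real.tan (h u) - Real.tan (h z) :=
  Convex.mul_sub_le_image_sub_of_le_deriv (convex_Icc z y)
    (fun _ hw => (hh.hasDerivAt_tan (hw.2.trans_lt hb.lt_one)).continuousAt.continuousWithinAt)
    (fun _ hw => (hh.hasDerivAt_tan ((interior_subset hw).2.trans_lt
      hb.lt_one)).differentiableAt.differentiableWithinAt)
    (fun w hw => by
      have hw' := interior_subset hw
      refine le_trans ?_ (hb.le_deriv w ⟨hz.trans hw'.1, hw'.2⟩)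
      have := mul_le_mul_of_nonneg_right (sub_le_sub_left hw'.1 y) hb.nonneg
      linarith) z ⟨le_rfl, hzu.trans hu⟩ u ⟨hzu, hu⟩ hzu

theorem TanBounds.monotoneOn (hb : TanBounds h y p q) (hh : IsProfile h) :
    MonotoneOn (fun y => Real.tan (h y)) (Icc 0 y) :=
  monotoneOn_of_deriv_nonneg (convex_Icc 0 y)
    (fun _ hw => (hh.hasDerivAt_tan (hw.2.trans_lt hb.lt_one)).continuousAt.continuousWithinAt)
    (fun _ hw => (hh.hasDerivAt_tan ((interior_subset hw).2.trans_lt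
      hb.lt_one)).differentiableAt.differentiableWithinAt)
    (fun w hw => hb.deriv_nonneg w (interior_subset hw))

theorem TanBounds.integral_auxB_le (hb : TanBounds h y p q) (hh : IsProfile h) {u : ℝ}
    (hu : u ∈ Icc 0 y) : ∫ z in (0 : ℝ)..u, auxB h z ≤ Real.tan (h y) * auxB h u := by
  have hc := hh.continuous_auxB
  have hc' := (hh.contDiff_auxB 1).continuous_deriv le_rfl
  rw [← hh.integral_deriv_auxB u, ← intervalIntegral.integral_const_mul]
  refine intervalIntegral.integral_mono_on hu.1 (Continuous.intervalIntegrable (by fun_prop) _ _)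
    (Continuous.intervalIntegrable (by fun_prop) _ _) fun z hz => ?_
  rw [hh.auxB_eq_tan_mul ((hz.2.trans hu.2).trans_lt hb.lt_one)]
  exact mul_le_mul_of_nonneg_right (hb.monotoneOn hh ⟨hz.1, hz.2.trans hu.2⟩
    ⟨hb.pos.le, le_rfl⟩ (hz.2.trans hu.2)) (hh.deriv_auxB_nonneg z)

theorem TanBounds.neg_waveTotal_le (hb : TanBounds h y p q) (hh : IsProfile h) {u : ℝ}
    (hu : u ∈ Icc 0 y) : -waveTotal (auxB h) u ≤ p * (deriv (auxB h) u * auxB h u) := by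
  have hc' := (hh.contDiff_auxB 1).continuous_deriv le_rfl
  have hku : Continuous (wronskQuot (auxB h) u) :=
    (continuous_wronskQuot (hh.contDiff_auxB 2)).comp (continuous_const.prodMk continuous_id)
  rw [← hh.integral_deriv_auxB u, ← intervalIntegral.integral_const_mul,
    ← intervalIntegral.integral_const_mul, waveTotal, ← intervalIntegral.integral_neg]
  refine intervalIntegral.integral_mono_on_of_le_Ioo hu.1
    (Continuous.intervalIntegrable (by fun_prop) _ _)
    (Continuous.intervalIntegrable (by fun_prop) _ _) fun z hz => ?_
  have h2 := hh.sub_mul_wronskQuot_auxB (hu.2.trans_lt hb.lt_one)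
    ((hz.2.trans_le hu.2).trans hb.lt_one)
  have h3 := mul_nonneg (hh.deriv_auxB_nonneg u) (hh.deriv_auxB_nonneg z)
  have h4 := mul_le_mul_of_nonneg_left (hb.tan_sub_le hh hz.1.le hz.2.le hu.2) h3
  refine le_of_mul_le_mul_left ?_ (sub_pos.2 hz.2)
  linarith

/-- On `[z, u]` the slope of `T` is at least `p - (y - z) q`. Integrating this against `B'` by parts
leaves a boundary term and `q ∫ B`, which is at most `q T(y) B(u)`. The subtracted term with `y - u`
disappears at `u = y`. -/
theorem TanBounds.le_neg_waveTotal (hb : TanBounds h y p q) (hh : IsProfile h) {u : ℝ}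
    (hu : u ∈ Icc 0 y) :
    (p - q * Real.tan (h y)) * (deriv (auxB h) u * auxB h u)
      - q * (deriv (auxB h) u * auxB h u * (y - u)) ≤ -waveTotal (auxB h) u := by
  have hB := hh.contDiff_auxB 1
  have hc := hB.continuous
  have hc' := hB.continuous_deriv le_rfl
  have hku : Continuous (wronskQuot (auxB h) u) :=
    (continuous_wronskQuot (hh.contDiff_auxB 2)).comp (continuous_const.prodMk continuous_id)
  have h1 : ∫ z in (0 : ℝ)..u, deriv (auxB h) u * (deriv (auxB h) z * (p - (y - z) * q))
      ≤ -waveTotal (auxB h) u := by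
    rw [waveTotal, ← intervalIntegral.integral_neg]
    refine intervalIntegral.integral_mono_on_of_le_Ioo hu.1
      (Continuous.intervalIntegrable (by fun_prop) _ _)
      (Continuous.intervalIntegrable (by fun_prop) _ _) fun z hz => ?_
    have h2 := hh.sub_mul_wronskQuot_auxB (hu.2.trans_lt hb.lt_one)
      ((hz.2.trans_le hu.2).trans hb.lt_one)
    have h3 := mul_nonneg (hh.deriv_auxB_nonneg u) (hh.deriv_auxB_nonneg z)
    have h4 := mul_le_mul_of_nonneg_left (hb.le_tan_sub hh hz.1.le hz.2.le hu.2) h3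
    refine le_of_mul_le_mul_left ?_ (sub_pos.2 hz.2)
    linarith
  have h2 : ∫ z in (0 : ℝ)..u, deriv (auxB h) z * (p - (y - z) * q)
      = auxB h u * (p - (y - u) * q) - q * ∫ z in (0 : ℝ)..u, auxB h z := by
    have := intervalIntegral.integral_eq_sub_of_hasDerivAt (a := 0) (b := u)
      (f := fun z => auxB h z * (p - (y - z) * q))
      (f' := fun z => deriv (auxB h) z * (p - (y - z) * q) + q * auxB h z)
      (fun z _ => by
        have e : HasDerivAt (fun z => p - (y - z) * q) q z := by
          simpa using (((hasDerivAt_id z).const_sub y).mul_const q).const_sub p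
        convert! (hB.differentiable one_ne_zero z).hasDerivAt.mul e using 1
        ring) (Continuous.intervalIntegrable (by fun_prop) _ _)
    rw [intervalIntegral.integral_add (Continuous.intervalIntegrable (by fun_prop) _ _)
      (Continuous.intervalIntegrable (by fun_prop) _ _), intervalIntegral.integral_const_mul,
      auxB_of_nonpos le_rfl] at this
    linarith
  rw [intervalIntegral.integral_const_mul, h2] at h1
  have h3 := mul_le_mul_of_nonneg_left (hb.integral_auxB_le hh hu)
    (mul_nonneg (hh.deriv_auxB_nonneg u) hb.nonneg)
  linarith

theorem TanBounds.neg_integral_waveTotal_le (hb : TanBounds h y p q) (hh : IsProfile h) :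
    -(∫ u in (0 : ℝ)..y, waveTotal (auxB h) u) ≤ p * (auxB h y ^ 2 / 2) := by
  have hB := hh.contDiff_auxB 1
  have hc := hB.continuous
  have hc' := hB.continuous_deriv le_rfl
  have hQ := continuous_waveTotal (hh.contDiff_auxB 2)
  rw [← hh.integral_deriv_mul_auxB, ← intervalIntegral.integral_const_mul,
    ← intervalIntegral.integral_neg]
  exact intervalIntegral.integral_mono_on hb.pos.le
    (Continuous.intervalIntegrable (by fun_prop) _ _)
    (Continuous.intervalIntegrable (by fun_prop) _ _) fun u hu => hb.neg_waveTotal_le hh hu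

/-- One of the two errors `q T` is inherited from the pointwise bound. The other comes from the term
with `y - u`: by parts it is `∫ B² / 2`, and monotonicity of `B` bounds this by `(B(y) / 2) ∫ B ≤
T(y) B(y)² / 2`. -/
theorem TanBounds.le_neg_integral_waveTotal (hb : TanBounds h y p q) (hh : IsProfile h) :
    (p - 2 * (q * Real.tan (h y))) * (auxB h y ^ 2 / 2)
      ≤ -(∫ u in (0 : ℝ)..y, waveTotal (auxB h) u) := by
  have hB := hh.contDiff_auxB 1
  have hc := hB.continuous
  have hc' := hB.continuous_deriv le_rfl
  have hQ := continuous_waveTotal (hh.contDiff_auxB 2)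
  have h1 := intervalIntegral.integral_mono_on (μ := volume) hb.pos.le
    (Continuous.intervalIntegrable (by fun_prop) _ _)
    (Continuous.intervalIntegrable (by fun_prop) _ _)
    fun u hu => hb.le_neg_waveTotal hh hu
  rw [intervalIntegral.integral_neg, intervalIntegral.integral_sub
    (Continuous.intervalIntegrable (by fun_prop) _ _)
    (Continuous.intervalIntegrable (by fun_prop) _ _), intervalIntegral.integral_const_mul,
    intervalIntegral.integral_const_mul, hh.integral_deriv_mul_auxB] at h1
  have h2 : ∫ u in (0 : ℝ)..y, deriv (auxB h) u * auxB h u * (y - u)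
      = ∫ u in (0 : ℝ)..y, auxB h u ^ 2 / 2 := by
    have := intervalIntegral.integral_eq_sub_of_hasDerivAt (a := 0) (b := y)
      (f := fun u => auxB h u ^ 2 / 2 * (y - u))
      (f' := fun u => deriv (auxB h) u * auxB h u * (y - u) - auxB h u ^ 2 / 2)
      (fun z _ => by
        convert! (((hB.differentiable one_ne_zero z).hasDerivAt.pow 2).div_const 2).mul
          ((hasDerivAt_id z).const_sub y) using 1
        simp; ring) (Continuous.intervalIntegrable (by fun_prop) _ _)
    rw [intervalIntegral.integral_sub (Continuous.intervalIntegrable (by fun_prop) _ _)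
      (Continuous.intervalIntegrable (by fun_prop) _ _), auxB_of_nonpos le_rfl] at this
    simp only [sub_self, mul_zero] at this
    linarith
  have h3 : ∫ u in (0 : ℝ)..y, auxB h u ^ 2 / 2 ≤ auxB h y / 2 * ∫ u in (0 : ℝ)..y, auxB h u := by
    rw [← intervalIntegral.integral_const_mul]
    refine intervalIntegral.integral_mono_on hb.pos.le
      (Continuous.intervalIntegrable (by fun_prop) _ _)
      (Continuous.intervalIntegrable (by fun_prop) _ _) fun u hu => ?_
    have := mul_le_mul_of_nonneg_right (hh.monotone_auxB hu.2) (hh.auxB_nonneg u)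
    linarith
  have h4 := mul_le_mul_of_nonneg_left (hb.integral_auxB_le hh ⟨hb.pos.le, le_rfl⟩)
    (half_pos (hh.auxB_pos hb.pos)).le
  have h5 := mul_le_mul_of_nonneg_left (h3.trans h4) hb.nonneg
  rw [h2] at h1
  linarith

theorem IsProfile.tan_pos (hh : IsProfile h) (hy : 0 < y) (hy1 : y < 1) : 0 < Real.tan (h y) :=
  Real.tan_pos_of_pos_of_lt_pi_div_two (hh.pos y hy hy1) (hh.lt_pi_div_two y hy hy1)

theorem cot_eq_inv_tan (x : ℝ) : Real.cot x = (Real.tan x)⁻¹ := by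
  rw [Real.cot_eq_cos_div_sin, Real.tan_eq_sin_div_cos, inv_div]

theorem TanBounds.deriv_auxB (hb : TanBounds h y p q) (hh : IsProfile h) :
    deriv (auxB h) y = auxB h y / Real.tan (h y) := by
  rw [hh.deriv_auxB_of_pos hb.pos, cot_eq_inv_tan, div_eq_inv_mul]

/-- The pointwise term contributes at most `-4(p - qT) / T²` and the integrated one at most `2p /
T²`, so the leading parts do not cancel. -/
theorem TanBounds.fluxTotal_le (hb : TanBounds h y p q) (hh : IsProfile h) :
    fluxTotal h y ≤ -(2 * (p - 2 * (q * Real.tan (h y))) / Real.tan (h y) ^ 2) := by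
  have hT := hh.tan_pos hb.pos hb.lt_one
  have hB := hh.auxB_pos hb.pos
  have h1 := hb.le_neg_waveTotal hh ⟨hb.pos.le, le_rfl⟩
  have h2 := hb.neg_integral_waveTotal_le hh
  rw [hb.deriv_auxB hh, sub_self, mul_zero, mul_zero, sub_zero] at h1
  have e1 := mul_le_mul_of_nonneg_left h1 (show 0 ≤ 4 / (Real.tan (h y) * auxB h y ^ 2) by
    positivity)
  have e2 := mul_le_mul_of_nonneg_left h2 (show 0 ≤ 4 / (Real.tan (h y) ^ 2 * auxB h y ^ 2) by
    positivity)
  have e3 : fluxTotal h y = -(4 / (Real.tan (h y) * auxB h y ^ 2) * -waveTotal (auxB h) y)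
      + 4 / (Real.tan (h y) ^ 2 * auxB h y ^ 2)
        * -∫ u in (0 : ℝ)..y, waveTotal (auxB h) u := by
    rw [fluxTotal, cot_eq_inv_tan]
    field_simp
    ring
  rw [e3]
  refine (add_le_add (neg_le_neg e1) e2).trans_eq ?_
  field_simp
  ring

/-- Here the two leading contributions `p / T` do cancel, and each error `qT` is divided by `T`. -/
theorem TanBounds.abs_selfPartDeriv_le (hb : TanBounds h y p q) (hh : IsProfile h) :
    |selfPartDeriv h y| ≤ 2 * q := by
  have hT := hh.tan_pos hb.pos hb.lt_one
  have hB := hh.auxB_pos hb.pos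
  have h1 := hb.le_neg_waveTotal hh ⟨hb.pos.le, le_rfl⟩
  have h2 := hb.neg_waveTotal_le hh ⟨hb.pos.le, le_rfl⟩
  have h3 := hb.neg_integral_waveTotal_le hh
  have h4 := hb.le_neg_integral_waveTotal hh
  rw [hb.deriv_auxB hh] at h1 h2
  rw [sub_self, mul_zero, mul_zero, sub_zero] at h1
  have hq := hb.nonneg
  have e3 := mul_le_mul_of_nonneg_left h3 (show 0 ≤ 2 / Real.tan (h y) by positivity)
  have e4 := mul_le_mul_of_nonneg_left h4 (show 0 ≤ 2 / Real.tan (h y) by positivity)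
  have hq2 : 0 ≤ q * auxB h y ^ 2 := by positivity
  rw [selfPartDeriv, cot_eq_inv_tan, abs_div, abs_of_pos (by positivity : 0 < auxB h y ^ 2),
    div_le_iff₀ (by positivity), abs_le]
  have i1 : (p - q * Real.tan (h y)) * (auxB h y / Real.tan (h y) * auxB h y)
      = p * auxB h y ^ 2 / Real.tan (h y) - q * auxB h y ^ 2 := by field_simp
  have i2 : p * (auxB h y / Real.tan (h y) * auxB h y) = p * auxB h y ^ 2 / Real.tan (h y) := by
    field_simp
  have i3 : 2 / Real.tan (h y) * (p * (auxB h y ^ 2 / 2)) = p * auxB h y ^ 2 / Real.tan (h y) := by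
    field_simp
  have i4 : 2 / Real.tan (h y) * ((p - 2 * (q * Real.tan (h y))) * (auxB h y ^ 2 / 2))
      = p * auxB h y ^ 2 / Real.tan (h y) - 2 * (q * auxB h y ^ 2) := by field_simp
  rw [i1] at h1
  rw [i2] at h2
  rw [i3] at e3
  rw [i4] at e4
  rw [← div_eq_mul_inv]
  constructor <;> linarith

/-- Integrating `(T B)' = T' B + B` gives `T(y) B(y) - ∫ B = ∫ T' B ≤ p ∫ B ≤ p T(y) B(y)`; then
divide by `T(y)`. -/
theorem TanBounds.sub_inv_tan_mul_integral_le (hb : TanBounds h y p q) (hh : IsProfile h) :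
    auxB h y - (Real.tan (h y))⁻¹ * (∫ z in (0 : ℝ)..y, auxB h z) ≤ p * auxB h y := by
  have hT := hh.tan_pos hb.pos hb.lt_one
  have hB := hh.contDiff_auxB 1
  have hc := hB.continuous
  have hd : ContinuousOn (deriv fun y => Real.tan (h y)) (uIcc 0 y) :=
    (hh.contDiffOn_tan.continuousOn_deriv_of_isOpen isOpen_Iio (by simp)).mono fun z hz => by
      rw [uIcc_of_le hb.pos.le] at hz
      exact hz.2.trans_lt hb.lt_one
  have hi : IntervalIntegrable (fun z => deriv (fun y => Real.tan (h y)) z * auxB h z)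
      volume 0 y := (hd.mul hc.continuousOn).intervalIntegrable
  have h1 := intervalIntegral.integral_eq_sub_of_hasDerivAt (a := 0) (b := y)
    (f := fun z => Real.tan (h z) * auxB h z)
    (f' := fun z => deriv (fun y => Real.tan (h y)) z * auxB h z + auxB h z)
    (fun z hz => by
      rw [uIcc_of_le hb.pos.le] at hz
      have hz1 := hz.2.trans_lt hb.lt_one
      convert! (hh.hasDerivAt_tan hz1).mul (hB.differentiable one_ne_zero z).hasDerivAt using 1
      rw [← hh.auxB_eq_tan_mul hz1]) (hi.add (hc.intervalIntegrable _ _))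
  rw [intervalIntegral.integral_add hi (hc.intervalIntegrable _ _), auxB_of_nonpos le_rfl,
    mul_zero, sub_zero] at h1
  have h2 : ∫ z in (0 : ℝ)..y, deriv (fun y => Real.tan (h y)) z * auxB h z
      ≤ p * ∫ z in (0 : ℝ)..y, auxB h z := by
    rw [← intervalIntegral.integral_const_mul]
    exact intervalIntegral.integral_mono_on hb.pos.le hi
      (Continuous.intervalIntegrable (by fun_prop) _ _)
      fun z hz => mul_le_mul_of_nonneg_right (hb.deriv_le z hz) (hh.auxB_nonneg z)
  have hy : y ∈ Icc 0 y := ⟨hb.pos.le, le_rfl⟩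
  have h3 := mul_le_mul_of_nonneg_left (hb.integral_auxB_le hh hy)
    ((hb.deriv_nonneg y hy).trans (hb.deriv_le y hy))
  refine le_of_mul_le_mul_left ?_ hT
  rw [mul_sub, mul_inv_cancel_left₀ hT.ne']
  linarith

/-- Each of `B'` and `B / T(y)` alone would contribute a term that need not vanish, so they are kept
together. Their difference is nonnegative, because `B(z) = T(z) B'(z) ≤ T(y) B'(z)`, so denominators
may be replaced by the lower bound `L` before integrating. -/
theorem TanBounds.abs_crossPartDeriv_le (hb : TanBounds h y p q) (hh : IsProfile h) {L : ℝ}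
    (hyL : 2 * y ≤ L) :
    |crossPartDeriv h L y| ≤ p / L + 2 * Real.tan (h y) / L ^ 2 := by
  have hT := hh.tan_pos hb.pos hb.lt_one
  have hB := hh.contDiff_auxB 1
  have hc := hB.continuous
  have hc' := hB.continuous_deriv le_rfl
  have hBy := hh.auxB_pos hb.pos
  have hL : 0 < L := by linarith [hb.pos]
  have hD : ∀ z ∈ uIcc 0 y, L ≤ 2 * L - y - z := fun z hz => by
    rw [uIcc_of_le hb.pos.le] at hz; linarith [hz.2]
  have hi : ∀ (n : ℕ) (f : ℝ → ℝ), Continuous f →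
      IntervalIntegrable (fun z => f z / (2 * L - y - z) ^ n) volume 0 y := fun n f hf =>
    (hf.continuousOn.div (by fun_prop) fun z hz =>
      pow_ne_zero n (by linarith [hD z hz])).intervalIntegrable
  have i1 := hi 1 _ hc'
  have i2 := (hi 2 _ hc).const_mul 2
  have i3 := (hi 1 _ hc).const_mul (Real.tan (h y))⁻¹
  simp only [pow_one] at i1 i3
  have e : crossPartDeriv h L y * auxB h y = ∫ z in (0 : ℝ)..y,
      (deriv (auxB h) z / (2 * L - y - z) + 2 * (auxB h z / (2 * L - y - z) ^ 2)
        - (Real.tan (h y))⁻¹ * (auxB h z / (2 * L - y - z))) := by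
    rw [intervalIntegral.integral_sub (i1.add i2) i3, intervalIntegral.integral_const_mul,
      crossPartDeriv, div_mul_cancel₀ _ hBy.ne', cot_eq_inv_tan, crossDeriv]
  have key : ∀ z ∈ Icc 0 y, 0 ≤ deriv (auxB h) z - (Real.tan (h y))⁻¹ * auxB h z := by
    intro z hz
    rw [sub_nonneg, inv_mul_le_iff₀ hT, hh.auxB_eq_tan_mul (hz.2.trans_lt hb.lt_one)]
    exact mul_le_mul_of_nonneg_right (hb.monotoneOn hh hz ⟨hb.pos.le, le_rfl⟩ hz.2)
      (hh.deriv_auxB_nonneg z)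
  have e2 : ∀ z, deriv (auxB h) z / (2 * L - y - z) + 2 * (auxB h z / (2 * L - y - z) ^ 2)
        - (Real.tan (h y))⁻¹ * (auxB h z / (2 * L - y - z))
      = (deriv (auxB h) z - (Real.tan (h y))⁻¹ * auxB h z) / (2 * L - y - z)
        + 2 * (auxB h z / (2 * L - y - z) ^ 2) := fun z => by ring
  have l1 : 0 ≤ crossPartDeriv h L y * auxB h y := by
    rw [e]
    refine intervalIntegral.integral_nonneg hb.pos.le fun z hz => ?_
    have := hD z (by rwa [uIcc_of_le hb.pos.le])
    rw [e2]
    exact add_nonneg (div_nonneg (key z hz) (by linarith))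
      (mul_nonneg zero_le_two (div_nonneg (hh.auxB_nonneg z) (sq_nonneg _)))
  have l2 : crossPartDeriv h L y * auxB h y ≤ ∫ z in (0 : ℝ)..y,
      ((deriv (auxB h) z - (Real.tan (h y))⁻¹ * auxB h z) / L + 2 / L ^ 2 * auxB h z) := by
    rw [e]
    refine intervalIntegral.integral_mono_on hb.pos.le ((i1.add i2).sub i3)
      (Continuous.intervalIntegrable (by fun_prop) _ _) fun z hz => ?_
    have hz' := hD z (by rwa [uIcc_of_le hb.pos.le])
    have k := key z hz
    have k' := hh.auxB_nonneg z
    rw [e2, div_mul_eq_mul_div, ← mul_div_assoc]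
    gcongr
  rw [intervalIntegral.integral_add (Continuous.intervalIntegrable (by fun_prop) _ _)
    (Continuous.intervalIntegrable (by fun_prop) _ _), intervalIntegral.integral_div,
    intervalIntegral.integral_sub (Continuous.intervalIntegrable (by fun_prop) _ _)
    (Continuous.intervalIntegrable (by fun_prop) _ _), intervalIntegral.integral_const_mul,
    intervalIntegral.integral_const_mul, hh.integral_deriv_auxB] at l2
  rw [abs_of_nonneg (nonneg_of_mul_nonneg_left l1 hBy)]
  refine le_of_mul_le_mul_right (l2.trans ?_) hBy
  have h3 := hb.integral_auxB_le hh ⟨hb.pos.le, le_rfl⟩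
  calc _ ≤ p * auxB h y / L + 2 / L ^ 2 * (Real.tan (h y) * auxB h y) := by
        gcongr
        exact hb.sub_inv_tan_mul_integral_le hh
    _ = _ := by ring

end

/-! ### Divergence at the light cone and the energy of a shell -/

section

variable {h : ℝ → ℝ} {lam t r : ℝ}

theorem IsProfile.tendsto_iteratedDeriv_tan (hh : IsProfile h) (n : ℕ) :
    Tendsto (iteratedDeriv n fun y => Real.tan (h y)) (𝓝[>] 0) (𝓝 0) := by
  refine Tendsto.mono_left ?_ nhdsWithin_le_nhds
  refine Metric.tendsto_nhds_nhds.2 fun ε hε => ?_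
  obtain ⟨δ, hδ, -, hb⟩ := hh.exists_abs_iteratedDeriv_tan_le n (half_pos hε)
  refine ⟨δ, hδ, fun y hy => ?_⟩
  rw [Real.dist_eq, sub_zero] at *
  linarith [hb y hy]

theorem IsProfile.differentiableAt_iteratedDeriv_tan (hh : IsProfile h) (n : ℕ) {y : ℝ}
    (hy : y < 1) : DifferentiableAt ℝ (iteratedDeriv n fun y => Real.tan (h y)) y := by
  have h1 := hh.contDiffOn_tan.differentiableOn_iteratedDerivWithin (m := n)
    (mod_cast WithTop.coe_lt_top _) isOpen_Iio.uniqueDiffOn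
  exact (h1.congr fun z hz => (iteratedDerivWithin_of_isOpen isOpen_Iio hz).symm).differentiableAt
    (Iio_mem_nhds hy)

/-- All derivatives of `T` vanish at `0`, so `T''' ≥ 0` makes `T''` and then `T'` nonnegative and
increasing on `[0, y]`. Their values at `y` therefore bound them on the interval. -/
theorem IsProfile.eventually_tanBounds (hh : IsProfile h)
    (h3 : ∀ᶠ y in 𝓝[>] (0 : ℝ), 0 ≤ iteratedDeriv 3 (fun x => Real.tan (h x)) y) :
    ∀ᶠ y in 𝓝[>] (0 : ℝ), TanBounds h y (deriv (fun x => Real.tan (h x)) y)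
      (iteratedDeriv 2 (fun x => Real.tan (h x)) y) := by
  obtain ⟨δ, hδ, hb⟩ := mem_nhdsGT_iff_exists_Ioo_subset.1 h3
  filter_upwards [Ioo_mem_nhdsGT hδ, Ioo_mem_nhdsGT one_pos] with y hyδ hy
  have hd : ∀ n, ∀ z ∈ Icc 0 y,
      DifferentiableAt ℝ (iteratedDeriv n fun y => Real.tan (h y)) z := fun n z hz =>
    hh.differentiableAt_iteratedDeriv_tan n (hz.2.trans_lt hy.2)
  have hmono : ∀ n, (∀ z ∈ Ioo 0 y, 0 ≤ iteratedDeriv (n + 1) (fun x => Real.tan (h x)) z) →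
      MonotoneOn (iteratedDeriv n fun x => Real.tan (h x)) (Icc 0 y) := fun n hn =>
    monotoneOn_of_deriv_nonneg (convex_Icc 0 y)
      (fun z hz => (hd n z hz).continuousAt.continuousWithinAt)
      (fun z hz => (hd n z (interior_subset hz)).differentiableWithinAt)
      (fun z hz => by rw [← iteratedDeriv_succ]; rw [interior_Icc] at hz; exact hn z hz)
  have h0 : (0 : ℝ) ∈ Icc 0 y := ⟨le_rfl, hy.1.le⟩
  have hyy : y ∈ Icc 0 y := ⟨hy.1.le, le_rfl⟩
  have m2 := hmono 2 fun z hz => hb ⟨hz.1, hz.2.trans hyδ.2⟩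
  have p2 : ∀ z ∈ Icc 0 y, 0 ≤ iteratedDeriv 2 (fun x => Real.tan (h x)) z := fun z hz => by
    rw [← hh.iteratedDeriv_tan_zero 2]; exact m2 h0 hz hz.1
  have m1 := hmono 1 fun z hz => p2 z (Ioo_subset_Icc_self hz)
  have z1 := hh.iteratedDeriv_tan_zero 1
  simp only [iteratedDeriv_one] at m1 z1
  refine ⟨hy.1, hy.2, p2 y hyy, fun z hz => ?_, fun z hz => m1 hz hyy hz.2, fun z hz => ?_⟩
  · rw [← z1]; exact m1 h0 hz hz.1
  · have := Convex.image_sub_le_mul_sub_of_deriv_le (convex_Icc 0 y)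
      (f := iteratedDeriv 1 fun x => Real.tan (h x))
      (C := iteratedDeriv 2 (fun x => Real.tan (h x)) y)
      (fun z hz => (hd 1 z hz).continuousAt.continuousWithinAt)
      (fun z hz => (hd 1 z (interior_subset hz)).differentiableWithinAt)
      (fun z hz => by
        rw [← iteratedDeriv_succ]
        exact m2 (interior_subset hz) hyy (interior_subset hz).2) z hz y hyy hz.2
    simp only [iteratedDeriv_one] at this
    linarith

/-- Since `T ≤ p y` and `q → 0`, the error `2qT` is at most `p / 2`, which leaves `-p / T² ≤ -1 / (y
T)`; finally `T ≤ 2h`. -/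
theorem IsProfile.eventually_fluxTotal_le (hh : IsProfile h)
    (h3 : ∀ᶠ y in 𝓝[>] (0 : ℝ), 0 ≤ iteratedDeriv 3 (fun x => Real.tan (h x)) y) :
    ∀ᶠ y in 𝓝[>] (0 : ℝ), fluxTotal h y ≤ -(1 / (2 * y * h y)) := by
  have hq := (hh.tendsto_iteratedDeriv_tan 2).eventually (Iio_mem_nhds one_pos)
  have hcos : ∀ᶠ y in 𝓝[>] (0 : ℝ), 1 / 2 < Real.cos (h y) := by
    have hc : ContinuousAt (fun y => Real.cos (h y)) 0 :=
      (Real.continuous_cos.comp hh.smooth.continuous).continuousAt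
    refine (hc.eventually (lt_mem_nhds ?_)).filter_mono nhdsWithin_le_nhds
    norm_num [hh.eq_zero 0 le_rfl]
  filter_upwards [hh.eventually_tanBounds h3, hq, hcos,
    Ioo_mem_nhdsGT (show (0 : ℝ) < 1 / 4 by norm_num)] with y hb hq hcos hy4
  set p := deriv (fun x => Real.tan (h x)) y
  set q := iteratedDeriv 2 (fun x => Real.tan (h x)) y
  have hy := hb.pos
  have hT := hh.tan_pos hb.pos hb.lt_one
  have hpos := hh.pos y hb.pos hb.lt_one
  have h1 := hb.tan_sub_le hh le_rfl hb.pos.le le_rfl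
  simp only [hh.eq_zero 0 le_rfl, Real.tan_zero, sub_zero] at h1
  have h2 : q * Real.tan (h y) ≤ p / 4 := by
    have hp : 0 ≤ p := hb.deriv_nonneg y ⟨hy.le, le_rfl⟩
    have hq' := hb.nonneg
    calc q * Real.tan (h y) ≤ 1 * (p * (1 / 4)) :=
          mul_le_mul (le_of_lt hq) (h1.trans (by gcongr; exact hy4.2.le)) hT.le zero_le_one
      _ = p / 4 := by ring
  have h5 : Real.tan (h y) ≤ 2 * h y := by
    have e : Real.tan (h y) * Real.cos (h y) = Real.sin (h y) := Real.tan_mul_cos (by linarith)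
    have := Real.sin_le hpos.le
    have := mul_lt_mul_of_pos_left hcos hT
    linarith
  refine (hb.fluxTotal_le hh).trans (neg_le_neg ?_)
  calc 1 / (2 * y * h y) = 1 / (y * (2 * h y)) := by ring_nf
    _ ≤ 1 / (y * Real.tan (h y)) := by gcongr
    _ = (Real.tan (h y) / y) / Real.tan (h y) ^ 2 := by field_simp
    _ ≤ 2 * (p - 2 * (q * Real.tan (h y))) / Real.tan (h y) ^ 2 := by
        gcongr
        rw [div_le_iff₀ hy]
        nlinarith

theorem tendsto_retarded_coordinate (hlam : 0 < lam) :
    Tendsto (fun r => lam * (t - r)) (𝓝[<] t) (𝓝[>] 0) := by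
  refine tendsto_nhdsWithin_iff.2 ⟨?_, ?_⟩
  · have : Continuous fun r => lam * (t - r) := by fun_prop
    simpa using (this.tendsto t).mono_left nhdsWithin_le_nhds
  · exact eventually_nhdsWithin_of_forall fun r hr => mul_pos hlam (sub_pos.2 hr)

theorem IsProfile.tendsto_deriv_calG (hh : IsProfile h) (hlam : 0 < lam) (ht : 0 < t)
    (h3 : ∀ᶠ y in 𝓝[>] (0 : ℝ), 0 ≤ iteratedDeriv 3 (fun x => Real.tan (h x)) y) :
    Tendsto (deriv (calG h lam t)) (𝓝[<] t) (𝓝 0) := by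
  have hL : 0 < lam * t := mul_pos hlam ht
  have l0 := hh.tendsto_iteratedDeriv_tan 0
  have l1 := hh.tendsto_iteratedDeriv_tan 1
  have l2 := hh.tendsto_iteratedDeriv_tan 2
  simp only [iteratedDeriv_one, iteratedDeriv_zero] at l0 l1
  have hV : Tendsto (fun y => -(4 * lam) * (selfPartDeriv h y + crossPartDeriv h (lam * t) y))
      (𝓝[>] 0) (𝓝 0) := by
    have hb : Tendsto (fun y => 2 * iteratedDeriv 2 (fun x => Real.tan (h x)) y
        + (deriv (fun x => Real.tan (h x)) y / (lam * t)
          + 2 * Real.tan (h y) / (lam * t) ^ 2)) (𝓝[>] 0) (𝓝 0) := by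
      simpa using (l2.const_mul 2).add
        ((l1.div_const (lam * t)).add ((l0.const_mul 2).div_const ((lam * t) ^ 2)))
    have : Tendsto (fun y => selfPartDeriv h y + crossPartDeriv h (lam * t) y) (𝓝[>] 0) (𝓝 0) := by
      refine squeeze_zero_norm' ?_ hb
      filter_upwards [hh.eventually_tanBounds h3, Ioo_mem_nhdsGT (half_pos hL)] with y hy hyL
      exact (norm_add_le _ _).trans (add_le_add (hy.abs_selfPartDeriv_le hh)
        (hy.abs_crossPartDeriv_le hh (by linarith [hyL.2])))
    simpa using this.const_mul (-(4 * lam))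
  refine (hV.comp (tendsto_retarded_coordinate hlam)).congr' ?_
  filter_upwards [Ioo_mem_nhdsLT ht] with r hr
  exact (hh.hasDerivAt_calG hlam hr.1 hr.2).deriv.symm

theorem IsProfile.continuousOn_deriv_calG_Ioc (hh : IsProfile h) (hlam : 0 < lam) (ht : 0 < t)
    (h3 : ∀ᶠ y in 𝓝[>] (0 : ℝ), 0 ≤ iteratedDeriv 3 (fun x => Real.tan (h x)) y) :
    ContinuousOn (deriv (calG h lam t)) (Ioc 0 t) := by
  intro r hr
  rcases hr.2.lt_or_eq with hrt | rfl
  · exact ((hh.continuousOn_deriv_calG hlam).continuousAt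
      (Ioo_mem_nhds hr.1 hrt)).continuousWithinAt
  -- The value at the light cone was computed directly from difference quotients, so it has to be
  -- matched with the limit from the left.
  · have h1 : ContinuousWithinAt (deriv (calG h lam r)) (Iio r) r := by
      rw [ContinuousWithinAt, (hh.hasDerivAt_calG_self hlam ht).deriv]
      exact hh.tendsto_deriv_calG hlam ht h3
    exact (continuousWithinAt_insert_self.2 h1).mono fun z hz => by
      rcases hz.2.lt_or_eq with h | h
      · exact Or.inr h
      · exact Or.inl h

theorem IsProfile.differentiableAt_calG (hh : IsProfile h) (hlam : 0 < lam) (hr : 0 < r)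
    (hrt : r ≤ t) : DifferentiableAt ℝ (calG h lam t) r := by
  rcases hrt.lt_or_eq with hrt | rfl
  · exact (hh.hasDerivAt_calG hlam hr hrt).differentiableAt
  · exact (hh.hasDerivAt_calG_self hlam hr).differentiableAt

/-- The second term of the energy density. -/
def calGTerm (h : ℝ → ℝ) (lam t r : ℝ) : ℝ :=
  1 / (32 * Real.pi ^ 2 * r ^ 2) * ((deriv (calG h lam t) r * r - calG h lam t r) / r ^ 2)

theorem energyDensity_eq (hr : r ≠ 0) (hd : DifferentiableAt ℝ (calG h lam t) r) :
    energyDensity h lam t r = fluxTerm h lam t r - calGTerm h lam t r := by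
  have : HasDerivAt (fun ρ => calG h lam t ρ / ρ)
      ((deriv (calG h lam t) r * r - calG h lam t r) / r ^ 2) r := by
    convert! hd.hasDerivAt.div (hasDerivAt_id r) hr using 1
    simp
  rw [energyDensity, this.deriv, calGTerm]

theorem continuousWithinAt_calGTerm {s : Set ℝ} (hr : r ≠ 0)
    (h1 : ContinuousWithinAt (calG h lam t) s r)
    (h2 : ContinuousWithinAt (deriv (calG h lam t)) s r) :
    ContinuousWithinAt (calGTerm h lam t) s r := by
  have hpi := Real.pi_ne_zero
  exact (ContinuousWithinAt.div (by fun_prop) (by fun_prop) (by positivity)).mul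
    (((h2.mul continuousWithinAt_id).sub h1).div (by fun_prop) (by simpa using hr))

theorem IsProfile.continuousOn_energyDensity (hh : IsProfile h) (hlam : 0 < lam) :
    ContinuousOn (energyDensity h lam t) (Ioo 0 t) := by
  refine ContinuousOn.congr (f := fun r => fluxTerm h lam t r - calGTerm h lam t r)
    ((hh.continuousOn_fluxTerm hlam).sub fun r hr => ?_)
    fun r hr => energyDensity_eq hr.1.ne' (hh.differentiableAt_calG hlam hr.1 hr.2.le)
  exact continuousWithinAt_calGTerm hr.1.ne'
    (hh.differentiableAt_calG hlam hr.1 hr.2.le).continuousAt.continuousWithinAt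
    (hh.continuousOn_deriv_calG hlam r hr)

theorem IsProfile.calGTerm_self (hh : IsProfile h) (hlam : 0 < lam) (ht : 0 < t) :
    calGTerm h lam t t = 0 := by
  rw [calGTerm, (hh.hasDerivAt_calG_self hlam ht).deriv, calG_of_nonpos (by simp)]
  simp

theorem IsProfile.energyDensity_self (hh : IsProfile h) (hlam : 0 < lam) (ht : 0 < t) :
    energyDensity h lam t t = 0 := by
  rw [energyDensity_eq ht.ne' (hh.differentiableAt_calG hlam ht le_rfl),
    hh.calGTerm_self hlam ht, hh.fluxTerm_of_nonpos (by simp), sub_zero]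

theorem IsProfile.energyDensity_of_lt (hh : IsProfile h) (hlam : 0 < lam) (htr : t < r) :
    energyDensity h lam t r = 0 := by
  have : (fun ρ => calG h lam t ρ / ρ) =ᶠ[𝓝 r] fun _ => 0 := by
    filter_upwards [Ioi_mem_nhds htr] with u hu
    rw [calG_of_nonpos (mul_nonpos_of_nonneg_of_nonpos hlam.le (sub_nonpos.2 (le_of_lt hu))),
      zero_div]
  rw [energyDensity, this.deriv_eq,
    hh.fluxTerm_of_nonpos (mul_nonpos_of_nonneg_of_nonpos hlam.le (sub_nonpos.2 htr.le))]
  simp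

/-- Near `0⁺` the profile is positive and at most `y`. -/
theorem IsProfile.eventually_pos_and_le (hh : IsProfile h) :
    ∀ᶠ y in 𝓝[>] (0 : ℝ), 0 < h y ∧ h y ≤ y := by
  have hd := (hh.smooth.differentiable (by simp) 0).hasDerivAt.isLittleO
  simp only [hh.deriv_zero, hh.eq_zero 0 le_rfl, sub_zero, smul_zero] at hd
  filter_upwards [nhdsWithin_le_nhds (Asymptotics.isLittleO_iff.1 hd one_pos),
    Ioo_mem_nhdsGT one_pos] with y h1 hy
  have := hh.pos y hy.1 hy.2
  rw [Real.norm_of_nonneg this.le, Real.norm_of_nonneg hy.1.le, one_mul] at h1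
  exact ⟨this, h1⟩

theorem IsProfile.eventually_fluxTerm_lt (hh : IsProfile h) (hlam : 0 < lam) (ht : 0 < t)
    (h3 : ∀ᶠ y in 𝓝[>] (0 : ℝ), 0 ≤ iteratedDeriv 3 (fun x => Real.tan (h x)) y) {C : ℝ}
    (hC : 0 < C) :
    ∀ᶠ r in 𝓝[<] t, fluxTerm h lam t r < -(C / h (lam * (t - r))) := by
  have hpi := Real.pi_pos
  -- Below this threshold for `y`, the extra factor `1 / y` in the flux outweighs `C`; using `t` in
  -- place of `r` is harmless since `r < t`.
  have hκ : 0 < lam ^ 2 / (32 * Real.pi ^ 2 * t ^ 2) / C := by positivity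
  filter_upwards [Ioo_mem_nhdsLT ht,
    (tendsto_retarded_coordinate hlam).eventually (hh.eventually_fluxTotal_le h3),
    (tendsto_retarded_coordinate hlam).eventually hh.eventually_pos_and_le,
    (tendsto_retarded_coordinate hlam).eventually (Ioo_mem_nhdsGT hκ)] with r hr hF hp hy
  have hr0 := hr.1
  rw [hh.fluxTerm_of_pos hy.1]
  set y := lam * (t - r)
  have hy0 := hy.1
  have hy1 := hy.2
  have hp0 := hp.1
  rw [lt_div_iff₀ hC] at hy1
  calc _ ≤ lam ^ 2 / (16 * Real.pi ^ 2 * r ^ 2) * -(1 / (2 * y * h y)) := by gcongr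
    _ = -(lam ^ 2 / (32 * Real.pi ^ 2 * r ^ 2) / y / h y) := by field_simp; ring
    _ < -(C / h y) := by
        refine neg_lt_neg (div_lt_div_of_pos_right ?_ hp0)
        rw [lt_div_iff₀ hy0, mul_comm]
        refine hy1.trans_le ?_
        gcongr
        exact hr.2.le

theorem IsProfile.eventually_energyDensity_lt (hh : IsProfile h) (hlam : 0 < lam) (ht : 0 < t)
    (h3 : ∀ᶠ y in 𝓝[>] (0 : ℝ), 0 ≤ iteratedDeriv 3 (fun x => Real.tan (h x)) y) {C : ℝ}
    (hC : 0 < C) :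
    ∀ᶠ r in 𝓝[<] t, energyDensity h lam t r < -(C / h (lam * (t - r))) := by
  have hlim : Tendsto (calGTerm h lam t) (𝓝[<] t) (𝓝 0) := by
    have := continuousWithinAt_calGTerm (s := Ioc 0 t) ht.ne'
      (hh.differentiableAt_calG hlam ht le_rfl).continuousAt.continuousWithinAt
      (hh.continuousOn_deriv_calG_Ioc hlam ht h3 t ⟨ht, le_rfl⟩)
    rw [ContinuousWithinAt, hh.calGTerm_self hlam ht] at this
    refine this.mono_left (le_inf nhdsWithin_le_nhds (le_principal_iff.2 ?_))
    exact mem_of_superset (Ioo_mem_nhdsLT ht) Ioo_subset_Ioc_self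
  -- The surplus `1 / h ≥ 1` absorbs the second term of the density, which tends to zero and so
  -- eventually exceeds `-1`.
  filter_upwards [hh.eventually_fluxTerm_lt hlam ht h3 (C := C + 1) (by positivity),
    hlim.eventually (Ioi_mem_nhds (show (-1 : ℝ) < 0 by norm_num)), Ioo_mem_nhdsLT ht,
    (tendsto_retarded_coordinate hlam).eventually hh.eventually_pos_and_le,
    (tendsto_retarded_coordinate hlam).eventually (Ioo_mem_nhdsGT one_pos)] with r h1 h2 hr hp hy
  rw [energyDensity_eq hr.1.ne' (hh.differentiableAt_calG hlam hr.1 hr.2.le)]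
  have h4 : 1 ≤ 1 / h (lam * (t - r)) := (one_le_div hp.1).2 (hp.2.trans hy.2.le)
  rw [add_div] at h1
  linarith

theorem IsProfile.tendsto_atBot_of_eventually_lt (hh : IsProfile h) (hlam : 0 < lam)
    {f : ℝ → ℝ} (hf : ∀ C : ℝ, 0 < C → ∀ᶠ r in 𝓝[<] t, f r < -(C / h (lam * (t - r)))) :
    Tendsto f (𝓝[<] t) atBot := by
  refine tendsto_atBot.2 fun b => ?_
  filter_upwards [hf (|b| + 1) (by positivity),
    (tendsto_retarded_coordinate hlam).eventually hh.eventually_pos_and_le,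
    (tendsto_retarded_coordinate hlam).eventually (Ioo_mem_nhdsGT one_pos)] with r h1 hp hy
  have h4 : |b| + 1 ≤ (|b| + 1) / h (lam * (t - r)) :=
    le_div_self (by positivity) hp.1 (hp.2.trans hy.2.le)
  linarith [neg_abs_le b]

/-- Just left of `t` the density is nonpositive and from `t` on it is zero, so its positive part
lives on a compact interval inside `(0, t)`, where continuity bounds it. -/
theorem IsProfile.lintegral_energyDensity_lt_top (hh : IsProfile h) (hlam : 0 < lam)
    (hneg : ∀ᶠ r in 𝓝[<] t, energyDensity h lam t r ≤ 0) (ht : 0 < t) {a : ℝ} (b : ℝ)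
    (ha : 0 < a) :
    ∫⁻ r in Ioo a b, ENNReal.ofReal (4 * Real.pi * r ^ 2 * energyDensity h lam t r) < ⊤ := by
  obtain ⟨l, hl, hlb⟩ := mem_nhdsLT_iff_exists_Ioo_subset.1 hneg
  have hc : ContinuousOn (fun r => 4 * Real.pi * r ^ 2 * energyDensity h lam t r) (Icc a l) :=
    ContinuousOn.mul (by fun_prop) ((hh.continuousOn_energyDensity hlam).mono
      fun r hr => ⟨ha.trans_le hr.1, hr.2.trans_lt hl⟩)
  obtain ⟨M, hM⟩ := isCompact_Icc.exists_bound_of_continuousOn hc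
  have hbound : ∀ r ∈ Ioo a b,
      ENNReal.ofReal (4 * Real.pi * r ^ 2 * energyDensity h lam t r) ≤ ENNReal.ofReal M := by
    intro r hr
    have hzero : energyDensity h lam t r ≤ 0 →
        ENNReal.ofReal (4 * Real.pi * r ^ 2 * energyDensity h lam t r) ≤ ENNReal.ofReal M := by
      intro h0
      rw [ENNReal.ofReal_of_nonpos]
      · exact zero_le
      · have := Real.pi_pos
        exact mul_nonpos_of_nonneg_of_nonpos (by positivity) h0
    rcases lt_trichotomy r t with hrt | rfl | hrt
    · rcases le_or_gt r l with hrl | hrl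
      · exact ENNReal.ofReal_le_ofReal ((le_abs_self _).trans (hM r ⟨hr.1.le, hrl⟩))
      · exact hzero (hlb ⟨hrl, hrt⟩)
    · exact hzero (hh.energyDensity_self hlam ht).le
    · exact hzero (hh.energyDensity_of_lt hlam hrt).le
  refine (setLIntegral_mono measurable_const hbound).trans_lt ?_
  rw [setLIntegral_const]
  exact ENNReal.mul_lt_top ENNReal.ofReal_lt_top (by simp)

theorem lintegral_Ioo_inv_sub_eq_top {l : ℝ} (hl : l < t) {κ : ℝ} (hκ : 0 < κ) :
    ∫⁻ r in Ioo l t, ENNReal.ofReal (κ / (t - r)) = ⊤ := by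
  by_contra hne
  have hm : Measurable fun r => κ / (t - r) := by fun_prop
  have hi : IntegrableOn (fun r => κ / (t - r)) (Ioo l t) := by
    refine ⟨hm.aestronglyMeasurable, ?_⟩
    rw [hasFiniteIntegral_iff_ofReal]
    · exact lt_top_iff_ne_top.2 hne
    · filter_upwards [ae_restrict_mem measurableSet_Ioo] with r hr
      exact div_nonneg hκ.le (sub_nonneg.2 hr.2.le)
  have h2 : IntervalIntegrable (fun r => (r - t)⁻¹) volume l t := by
    rw [intervalIntegrable_iff_integrableOn_Ioo_of_le hl.le]
    refine (hi.const_mul (-κ⁻¹)).congr (ae_of_all _ fun r => ?_)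
    simp only
    rw [← neg_sub t r, inv_neg]
    field_simp
  rw [intervalIntegrable_sub_inv_iff] at h2
  rcases h2 with h2 | h2
  · exact hl.ne h2
  · exact h2 right_mem_uIcc

/-- Already the bound with constant `1` suffices: `1 / h(y) ≥ 1 / y` near the origin, and `1 / (λ(t
- r))` has a logarithmically divergent integral at `t`. -/
theorem IsProfile.lintegral_neg_energyDensity_eq_top (hh : IsProfile h) (hlam : 0 < lam)
    (hlt : ∀ᶠ r in 𝓝[<] t, energyDensity h lam t r < -(1 / h (lam * (t - r)))) {a b : ℝ}
    (ha : 0 < a) (hat : a < t) (htb : t < b) :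
    ∫⁻ r in Ioo a b, ENNReal.ofReal (-(4 * Real.pi * r ^ 2 * energyDensity h lam t r)) = ⊤ := by
  have hpi := Real.pi_pos
  have hev : ∀ᶠ r in 𝓝[<] t, a < r ∧ 4 * Real.pi * a ^ 2 / lam / (t - r)
      ≤ -(4 * Real.pi * r ^ 2 * energyDensity h lam t r) := by
    filter_upwards [hlt, Ioo_mem_nhdsLT hat,
      (tendsto_retarded_coordinate hlam).eventually hh.eventually_pos_and_le] with r h1 hr hp
    refine ⟨hr.1, ?_⟩
    have hy : 0 < t - r := sub_pos.2 hr.2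
    have h2 : 1 / (lam * (t - r)) ≤ -energyDensity h lam t r := by
      have := one_div_le_one_div_of_le hp.1 hp.2
      linarith
    have har := hr.1.le
    calc 4 * Real.pi * a ^ 2 / lam / (t - r) = 4 * Real.pi * a ^ 2 * (1 / (lam * (t - r))) := by
          field_simp
      _ ≤ 4 * Real.pi * r ^ 2 * -energyDensity h lam t r := by gcongr
      _ = _ := by ring
  obtain ⟨l, hl, hlb⟩ := mem_nhdsLT_iff_exists_Ioo_subset.1 hev
  rw [eq_top_iff, ← lintegral_Ioo_inv_sub_eq_top hl
    (show 0 < 4 * Real.pi * a ^ 2 / lam by positivity)]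
  refine (setLIntegral_mono' measurableSet_Ioo fun r hr =>
    ENNReal.ofReal_le_ofReal (hlb hr).2).trans (lintegral_mono_set fun r hr => ?_)
  exact ⟨(hlb hr).1, hr.2.trans htb⟩

end

end PointSource

end

theorem mainTheorem3 (h : ℝ → ℝ) (hh : PointSource.IsProfile h)
    (lam : ℝ) (hlam : 0 < lam) (t : ℝ) (ht : 0 < t) :
    -- pointwise existence for `0 < r ≤ t`, and continuity in `r` for `0 < r < t`
    ((∀ K : ℝ, 0 < K → Differentiable ℝ (PointSource.modeR h K)) ∧
      (∀ r : ℝ, 0 < r → r ≤ t →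
        IntegrableOn (PointSource.fluxIntegrand h lam t r) (Ioi 0) ∧
        PointSource.HasImproperIntegral (PointSource.calGIntegrand h lam t r)
          (PointSource.calG h lam t r) ∧
        DifferentiableAt ℝ (PointSource.calG h lam t) r) ∧
      ContinuousOn (PointSource.fluxTerm h lam t) (Ioo 0 t) ∧
      ContinuousOn (deriv (PointSource.calG h lam t)) (Ioo 0 t) ∧
      ContinuousOn (PointSource.energyDensity h lam t) (Ioo 0 t) ∧
      PointSource.energyDensity h lam t t = 0) ∧
    -- behaviour as `r → t⁻` when `(tan h)''' ≥ 0` near `0⁺`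
    ((∀ᶠ y in 𝓝[>] (0 : ℝ), 0 ≤ iteratedDeriv 3 (fun x : ℝ => Real.tan (h x)) y) →
      ContinuousOn (deriv (PointSource.calG h lam t)) (Ioc 0 t) ∧
      deriv (PointSource.calG h lam t) t = 0 ∧
      Tendsto (PointSource.fluxTerm h lam t) (𝓝[<] t) atBot ∧
      (∀ C : ℝ, 0 < C → ∀ᶠ r in 𝓝[<] t,
        PointSource.fluxTerm h lam t r < -(C / h (lam * (t - r)))) ∧
      Tendsto (PointSource.energyDensity h lam t) (𝓝[<] t) atBot ∧
      (∀ C : ℝ, 0 < C → ∀ᶠ r in 𝓝[<] t,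
        PointSource.energyDensity h lam t r < -(C / h (lam * (t - r)))) ∧
      -- the energy in every shell around `r = t` is `-∞`
      (∀ a b : ℝ, 0 < a → a < t → t < b →
        (∫⁻ r in Ioo a b,
          ENNReal.ofReal (4 * Real.pi * r ^ 2 * PointSource.energyDensity h lam t r)) < ⊤ ∧
        (∫⁻ r in Ioo a b,
          ENNReal.ofReal (-(4 * Real.pi * r ^ 2 * PointSource.energyDensity h lam t r))) = ⊤)) := by
  refine ⟨⟨fun K _ => hh.differentiable_modeR K, fun r hr hrt =>
    ⟨hh.integrableOn_fluxIntegrand, hh.hasImproperIntegral_calG hlam hr,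
      hh.differentiableAt_calG hlam hr hrt⟩, hh.continuousOn_fluxTerm hlam,
    hh.continuousOn_deriv_calG hlam, hh.continuousOn_energyDensity hlam,
    hh.energyDensity_self hlam ht⟩, fun h3 => ?_⟩
  have hflux : ∀ C : ℝ, 0 < C → ∀ᶠ r in 𝓝[<] t,
      PointSource.fluxTerm h lam t r < -(C / h (lam * (t - r))) := fun C hC =>
    hh.eventually_fluxTerm_lt hlam ht h3 hC
  have hdens : ∀ C : ℝ, 0 < C → ∀ᶠ r in 𝓝[<] t,
      PointSource.energyDensity h lam t r < -(C / h (lam * (t - r))) := fun C hC =>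
    hh.eventually_energyDensity_lt hlam ht h3 hC
  have hbot := hh.tendsto_atBot_of_eventually_lt hlam hdens
  exact ⟨hh.continuousOn_deriv_calG_Ioc hlam ht h3, (hh.hasDerivAt_calG_self hlam ht).deriv,
    hh.tendsto_atBot_of_eventually_lt hlam hflux, hflux, hbot, hdens, fun a b ha hat htb =>
    ⟨hh.lintegral_energyDensity_lt_top hlam (hbot.eventually (eventually_le_atBot 0)) ht b ha,
      hh.lintegral_neg_energyDensity_eq_top hlam (hdens 1 one_pos) ha hat htb⟩⟩
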